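/- Let $\mathbb O$ be a monster model of a complete first-order theory $T$ in a language $L$: for some cardinal $\kappa>|L|+\aleph_0$, $\mathbb O$ is $\kappa$-saturated and strongly $\kappa$-homogeneous. Let $A\subseteq\mathbb O$ be a small set, $|A|<\kappa$. Tuples of variables may be finite or infinite, and of any length. $S_{\bar x}(A)$ is the space of complete types over $A$ in the variables $\bar x$. A global type is an element $p(\bar x)$ of $S_{\bar x}(\mathbb O)$; it is $A$-invariant if it is fixed by $\mathrm{Aut}(\mathbb O/A)$, and an $A$-coheir if it is finitely satisfiable in $A$. $A$ is an invariance base if every type over $A$ extends to a global $A$-invariant type. A sequence $(b_i)_{i<n}$ of tuples is an invariant sequence over $A$ if $b_i\equiv_A b_j$ for all $i,j<n$ and, for each $i<n$, $\mathrm{tp}(b_i/Ab_{<i})$ extends to a global $A$-invariant type. (For tuples too long to be realized in $\mathbb O$, a type over $A$ is called the type of an invariant sequence if its restriction to each finite subtuple $\bar x'$ of the variables $\bar x$ of the terms of the sequence, the same $\bar x'$ for each term, is the type of an invariant sequence in $\mathbb O$.) Given a class $\mathcal I$ of $A$-invariant types, a type is reliably in $\mathcal I$ if it belongs to the largest class $\mathcal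 R\subseteq\mathcal I$ such that 1. if $p(\bar x,\bar y)\in\mathcal R$, then its restriction to $\bar x$ is in $\mathcal R$; 2. if $p(\bar x)\in\mathcal R$ and $q(\bar x,\bar y)\in S(A)$ extends $p{\upharpoonright}A$, then some $r(\bar x,\bar y)\in\mathcal R$ extends $p(\bar x)\cup q(\bar x,\bar y)$; 3. if $p(\bar x_0)\in\mathcal R$ and $q(\bar x_0,\dots,\bar x_{n-1})\in S(A)$, $n\ge 1$, extends $(p{\upharpoonright}A)(\bar x_0)$ and is the type of an invariant sequence over $A$, then some $r(\bar x_0,\dots,\bar x_{n-1})\in\mathcal R$ extends $p(\bar x_0)\cup\dots\cup p(\bar x_{n-1})\cup q(\bar x_0,\dots,\bar x_{n-1})$. (Classes of types are regarded up to renaming of variables in this definition.) A type is reliably $A$-invariant, respectively a reliable $A$-coheir, if it is reliably in the class of all $A$-invariant types, respectively of all $A$-coheirs. A formula $\varphi(x,c)$ Kim-divides over $A$ if there are a global $A$-invariant type $q(y)\supseteq\mathrm{tp}(c/A)$ and a Morley sequence $(e_i)_{i<\omega}$ generated by $q$ over $A$ (that is, $e_i\models q{\upharpoonright}Ae_{<i}$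 for all $i$) with $\{\varphi(x,e_i):i<\omega\}$ inconsistent. A formula Kim-forks over $A$ if it implies a finite disjunction of formulas that Kim-divide over $A$. An $A$-invariant type $p(\bar x)$ is Kim-strictly $A$-invariant if, whenever $a\models p{\upharpoonright}Ab$, no formula in $\mathrm{tp}(b/Aa)$ Kim-forks over $A$. Then the following hold. (a) Let $\mathcal I$ be a class of $A$-invariant types such that every type over $A$ extends to a member of $\mathcal I$; for each tuple of variables $\bar x$, $S_{\bar x}(\mathbb O)\cap\mathcal I$ is closed in $S_{\bar x}(\mathbb O)$; $\mathcal I$ is invariant under renaming variables; and an $A$-invariant type is in $\mathcal I$ if and only if all its restrictions to finitely many variables are in $\mathcal I$. Then for every $q(\bar x)\in S_{\bar x}(A)$ there is an $A$-invariant type $p(\bar x)\supseteq q(\bar x)$ that is reliably in $\mathcal I$. (b) Every reliably $A$-invariant type is Kim-strictly $A$-invariant. (c) If $A$ is an invariance base, then every type over $A$ extends to a reliably $A$-invariant type, which is also Kim-strictly $A$-invariant. (d) If $A$ is a model (the universe of an elementary substructure of $\mathbb O$), then every type over $A$ extends to a reliable $A$-coheir, which is also Kim-strictly $A$-invariant.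 In particular, every type over a model $M$ has a Kim-strictly $M$-invariant extension (Kruckman–Ramsey). -/

import Mathlib

open Cardinal Set FirstOrder

universe u v w x y

namespace ReliableTypes

open FirstOrder.Language FirstOrder.Language.Theory

/-! ### Complete types over sets of parameters and their restrictions -/

section Types

variable {L : FirstOrder.Language.{u, v}}

/-- The preimage of a maximal consistent theory under a map of languages is maximal consistent. -/
theorem isMaximal_preimage {L₁ : FirstOrder.Language.{u, v}} {L₂ : FirstOrder.Language.{x, y}} (g : L₁ →ᴸ L₂)
    {S : L₂.Theory} (hS : S.IsMaximal) :
    Theory.IsMaximal {φ : L₁.Sentence | g.onSentence φ ∈ S} := by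
  refine ⟨?_, fun φ => ?_⟩
  · have h : (g.onTheory {φ : L₁.Sentence | g.onSentence φ ∈ S}).IsSatisfiable := by
      refine hS.1.mono ?_
      rintro _ ⟨φ, hφ, rfl⟩
      exact hφ
    exact Theory.isSatisfiable_of_isSatisfiable_onTheory g h
  · exact hS.mem_or_not_mem (g.onSentence φ)

/-- The restriction `p(x)` of a complete type `p(x, y)` to some of its variables, along the map
`f` of variables: `φ(x) ∈ p.restrictVars f` if and only if `φ(f(x)) ∈ p`. -/
def restrictVars {L : FirstOrder.Language.{u, v}} {T : L.Theory} {α : Type x} {β : Type y} (f : α → β)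
    (p : T.CompleteType β) : T.CompleteType α where
  toTheory := {φ | (L.lhomWithConstantsMap f).onSentence φ ∈ p}
  subset' := by
    rintro _ ⟨φ, hφ, rfl⟩
    have h : (L.lhomWithConstants β).onSentence φ ∈ p := p.subset ⟨φ, hφ, rfl⟩
    have h' : (L.lhomWithConstantsMap f).onSentence ((L.lhomWithConstants α).onSentence φ) =
        (L.lhomWithConstants β).onSentence φ := by
      rw [← LHom.map_constants_comp_sumInl (L := L) (f := f)]
      exact (congrFun (LHom.comp_onBoundedFormula _ _) φ).symm
    change (L.lhomWithConstantsMap f).onSentence ((L.lhomWithConstants α).onSentence φ) ∈ p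
    rw [h']
    exact h
  isMaximal' := isMaximal_preimage _ p.isMaximal

variable (L) {M : Type w} [L.Structure M]

/-- `S_α(A)`: complete types over the parameter set `A` in a tuple of variables indexed by `α`
(computed in the structure `M`). -/
abbrev TypeOver (A : Set M) (α : Type x) := (L[[A]].completeTheory M).CompleteType α

variable (M) in
/-- `S_α(M)`: global types in a tuple of variables indexed by `α`. -/
abbrev GlobalType (α : Type x) := (L.elementaryDiagram M).CompleteType α

variable {L}

/-- `Holds p φ` says that the formula `φ(c, x)` is in the type `p(x)`. In `φ`, variables in `C` are
to be replaced by the corresponding parameters, those in `α` are the variables of the type. -/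
def Holds {C : Type y} {α : Type x} {T : L[[C]].Theory} (p : T.CompleteType α)
    (φ : L.Formula (C ⊕ α)) : Prop :=
  Formula.equivSentence (L := L[[C]]) (BoundedFormula.constantsVarsEquiv.symm φ) ∈ p

/-- `p ↾ A`, the restriction of a global type to the parameter set `A`. -/
def restrictParams (A : Set M) {α : Type x} (p : GlobalType L M α) : TypeOver L A α where
  toTheory := {φ | ((L.lhomWithConstantsMap ((↑) : A → M)).addConstants α).onSentence φ ∈ p}
  subset' := by
    rintro _ ⟨φ, hφ, rfl⟩
    have h1 : (L.lhomWithConstantsMap ((↑) : A → M)).onSentence φ ∈ L.elementaryDiagram M := by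
      have : (LHom.constantsOnMap ((↑) : A → M)).IsExpansionOn M :=
        constantsOnMap_isExpansionOn rfl
      have : (L.lhomWithConstantsMap ((↑) : A → M)).IsExpansionOn M :=
        LHom.sumMap_isExpansionOn _ _ M
      have := (LHom.realize_onSentence M (L.lhomWithConstantsMap ((↑) : A → M)) φ).2 hφ
      exact this
    have h2 : (L[[M]].lhomWithConstants α).onSentence
        ((L.lhomWithConstantsMap ((↑) : A → M)).onSentence φ) ∈ p := p.subset ⟨_, h1, rfl⟩
    have h3 : ((L.lhomWithConstantsMap ((↑) : A → M)).addConstants α).onSentence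
        ((L[[A]].lhomWithConstants α).onSentence φ) =
        (L[[M]].lhomWithConstants α).onSentence
        ((L.lhomWithConstantsMap ((↑) : A → M)).onSentence φ) := by
      have e1 := (congrFun (LHom.comp_onBoundedFormula (n := 0) (α := Empty)
        ((L.lhomWithConstantsMap ((↑) : A → M)).addConstants α) (L[[A]].lhomWithConstants α)) φ)
      have e2 := (congrFun (LHom.comp_onBoundedFormula (n := 0) (α := Empty)
        (L[[M]].lhomWithConstants α) (L.lhomWithConstantsMap ((↑) : A → M))) φ)
      exact e1.symm.trans e2
    change ((L.lhomWithConstantsMap ((↑) : A → M)).addConstants α).onSentence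
        ((L[[A]].lhomWithConstants α).onSentence φ) ∈ p
    rw [h3]
    exact h2
  isMaximal' := isMaximal_preimage _ p.isMaximal

variable (L) in
/-- `tp(a/A)` for a tuple `a` of elements of `M`. -/
def tp [Nonempty M] (A : Set M) {α : Type x} (a : α → M) : TypeOver L A α :=
  (L[[A]].completeTheory M).typeOf a

theorem realize_code {C : Type y} {α : Type x} {N : Type*} [L.Structure N] [L[[C]].Structure N]
    [(L.lhomWithConstants C).IsExpansionOn N] [L[[C]][[α]].Structure N]
    [(L[[C]].lhomWithConstants α).IsExpansionOn N] (φ : L.Formula (C ⊕ α)) :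
    (Formula.equivSentence (L := L[[C]]) (BoundedFormula.constantsVarsEquiv.symm φ)).Realize N ↔
      φ.Realize (Sum.elim (fun c => (L.con c : N)) (fun a => (L[[C]].con a : N))) := by
  rw [Formula.realize_equivSentence]
  unfold Formula.Realize
  rw [← BoundedFormula.realize_constantsVarsEquiv, Equiv.apply_symm_apply]

theorem holds_tp [Nonempty M] (A : Set M) {α : Type x} (a : α → M) (φ : L.Formula (A ⊕ α)) :
    Holds (tp L A a) φ ↔ φ.Realize (Sum.elim (fun c : A => (c : M)) a) := by
  unfold Holds tp
  rw [CompleteType.formula_mem_typeOf]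
  unfold Formula.Realize
  rw [← BoundedFormula.realize_constantsVarsEquiv, Equiv.apply_symm_apply]
  rfl

theorem holds_restrictVars {C : Type w} {α : Type x} {β : Type y} {T : L[[C]].Theory} (f : α → β)
    (p : T.CompleteType β) (φ : L.Formula (C ⊕ α)) :
    Holds (restrictVars f p) φ ↔ Holds p (φ.relabel (Sum.map id f)) := by
  change (L[[C]].lhomWithConstantsMap f).onSentence _ ∈ (p : L[[C]][[β]].Theory) ↔
    _ ∈ (p : L[[C]][[β]].Theory)
  rw [p.isMaximal.mem_iff_models, p.isMaximal.mem_iff_models, models_sentence_iff,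
    models_sentence_iff]
  refine forall_congr' fun N => ?_
  let s1 : L[[C]].Structure N := (L[[C]].lhomWithConstants β).reduct N
  let s0 : L.Structure N := (L.lhomWithConstants C).reduct N
  let s2 : L[[C]][[α]].Structure N := (L[[C]].lhomWithConstantsMap f).reduct N
  have : (L.lhomWithConstants C).IsExpansionOn N := LHom.isExpansionOn_reduct _ _
  have : (L[[C]].lhomWithConstants β).IsExpansionOn N := LHom.isExpansionOn_reduct _ _
  have : (L[[C]].lhomWithConstantsMap f).IsExpansionOn N := LHom.isExpansionOn_reduct _ _
  have : (L[[C]].lhomWithConstants α).IsExpansionOn N := ⟨fun _ _ => rfl, fun _ _ => rfl⟩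
  rw [LHom.realize_onSentence, realize_code, realize_code, Formula.realize_relabel]
  refine iff_of_eq (congrArg _ ?_)
  funext z
  rcases z with z | z
  · rfl
  · change _ = Structure.funMap _ _
    rfl

theorem holds_restrictParams (A : Set M) {α : Type x} (p : GlobalType L M α)
    (φ : L.Formula (A ⊕ α)) :
    Holds (restrictParams A p) φ ↔ Holds p (φ.relabel (Sum.map (fun c : A => (c : M)) id)) := by
  change ((L.lhomWithConstantsMap ((↑) : A → M)).addConstants α).onSentence _ ∈
    (p : L[[M]][[α]].Theory) ↔ _ ∈ (p : L[[M]][[α]].Theory)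
  rw [p.isMaximal.mem_iff_models, p.isMaximal.mem_iff_models, models_sentence_iff,
    models_sentence_iff]
  refine forall_congr' fun N => ?_
  let s1 : L[[M]].Structure N := (L[[M]].lhomWithConstants α).reduct N
  let s0 : L.Structure N := (L.lhomWithConstants M).reduct N
  let s2 : L[[A]].Structure N := (L.lhomWithConstantsMap ((↑) : A → M)).reduct N
  let s3 : L[[A]][[α]].Structure N :=
    ((L.lhomWithConstantsMap ((↑) : A → M)).addConstants α).reduct N
  have : (L.lhomWithConstants M).IsExpansionOn N := LHom.isExpansionOn_reduct _ _
  have : (L[[M]].lhomWithConstants α).IsExpansionOn N := LHom.isExpansionOn_reduct _ _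
  have : ((L.lhomWithConstantsMap ((↑) : A → M)).addConstants α).IsExpansionOn N :=
    LHom.isExpansionOn_reduct _ _
  have : (L.lhomWithConstants A).IsExpansionOn N := ⟨fun _ _ => rfl, fun _ _ => rfl⟩
  have : (L[[A]].lhomWithConstants α).IsExpansionOn N := ⟨fun _ _ => rfl, fun _ _ => rfl⟩
  rw [LHom.realize_onSentence, realize_code, realize_code, Formula.realize_relabel]
  refine iff_of_eq (congrArg _ ?_)
  funext z
  rcases z with z | z
  · rfl
  · rfl

theorem holds_relabel_relabel {C D E : Type*} {α : Type x} {T : L[[C]].Theory}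
    (p : T.CompleteType α) (f : D → E) (g : E → C ⊕ α) (φ : L.Formula D) :
    Holds p ((φ.relabel f).relabel g) ↔ Holds p (φ.relabel (g ∘ f)) := by
  change _ ∈ (p : L[[C]][[α]].Theory) ↔ _ ∈ (p : L[[C]][[α]].Theory)
  rw [p.isMaximal.mem_iff_models, p.isMaximal.mem_iff_models, models_sentence_iff,
    models_sentence_iff]
  refine forall_congr' fun N => ?_
  let s1 : L[[C]].Structure N := (L[[C]].lhomWithConstants α).reduct N
  let s0 : L.Structure N := (L.lhomWithConstants C).reduct N
  have : (L.lhomWithConstants C).IsExpansionOn N := LHom.isExpansionOn_reduct _ _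
  have : (L[[C]].lhomWithConstants α).IsExpansionOn N := LHom.isExpansionOn_reduct _ _
  rw [realize_code, realize_code, Formula.realize_relabel, Formula.realize_relabel,
    Formula.realize_relabel, Function.comp_assoc]

theorem ext_holds {C : Type w} {α : Type x} {T : L[[C]].Theory} {p q : T.CompleteType α}
    (h : ∀ φ : L.Formula (C ⊕ α), Holds p φ ↔ Holds q φ) : p = q := by
  refine SetLike.ext fun s => ?_
  have := h (BoundedFormula.constantsVarsEquiv (Formula.equivSentence.symm s))
  unfold Holds at this
  simpa using this

theorem restrictVars_tp [Nonempty M] (A : Set M) {α : Type x} {β : Type y} (f : α → β)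
    (b : β → M) : restrictVars f (tp L A b) = tp L A (b ∘ f) := by
  refine ext_holds fun φ => ?_
  rw [holds_restrictVars, holds_tp, holds_tp, Formula.realize_relabel]
  refine iff_of_eq (congrArg _ ?_)
  funext z
  rcases z with z | z <;> rfl

theorem restrictParams_restrictVars (A : Set M) {α : Type x} {β : Type y} (f : α → β)
    (p : GlobalType L M β) :
    restrictParams A (restrictVars f p) = restrictVars f (restrictParams A p) := by
  refine ext_holds fun φ => ?_
  rw [holds_restrictVars, holds_restrictParams, holds_restrictVars, holds_restrictParams,
    holds_relabel_relabel, holds_relabel_relabel, Sum.map_comp_map, Sum.map_comp_map]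
  rfl

theorem restrictParams_tp_mono [Nonempty M] {A B : Set M} (h : A ⊆ B) {α : Type x}
    {p : GlobalType L M α} {a : α → M} (hp : restrictParams B p = tp L B a) :
    restrictParams A p = tp L A a := by
  refine ext_holds fun φ => ?_
  have h1 : Holds (restrictParams B p) (φ.relabel (Sum.map (Set.inclusion h) id)) ↔
      Holds (tp L B a) (φ.relabel (Sum.map (Set.inclusion h) id)) := by rw [hp]
  rw [holds_restrictParams, holds_relabel_relabel, Sum.map_comp_map, holds_tp,
    Formula.realize_relabel] at h1
  rw [holds_restrictParams, holds_tp]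
  refine h1.trans (iff_of_eq (congrArg _ ?_))
  funext z
  rcases z with z | z <;> rfl

end Types

/-! ### The monster model, invariance, coheirs -/

section Invariance

variable (L : FirstOrder.Language.{u, v}) (M : Type w) [L.Structure M] [Nonempty M]

/-- `M` is a monster model at the cardinal `κ`: `κ` is uncountable and exceeds the size of the
language, `M` is `κ`-saturated, and `M` is strongly `κ`-homogeneous (every partial elementary map
with domain of size less than `κ` extends to an automorphism). Subsets of `M` of size less than `κ`
are the small ones. -/
structure IsMonster (κ : Cardinal.{w}) : Prop where
  uncountable : ℵ₀ < κ
  card_language_lt : Cardinal.lift.{w} L.card < Cardinal.lift.{max u v} κ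
  saturated : ∀ B : Set M, #B < κ → ∀ q : TypeOver L B (Fin 1), ∃ b : Fin 1 → M, tp L B b = q
  homogeneous : ∀ (B : Set M) (f : B → M), #B < κ →
    (∀ φ : L.Formula B, φ.Realize (fun b => (b : M)) ↔ φ.Realize f) →
    ∃ σ : M ≃[L] M, ∀ b : B, σ b = f b

variable {L M}

/-- A global type is `A`-invariant if it is fixed by all automorphisms fixing `A` pointwise. -/
def IsInvariantOver (A : Set M) {α : Type x} (p : GlobalType L M α) : Prop :=
  ∀ σ : M ≃[L] M, (∀ a ∈ A, σ a = a) →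
    ∀ φ : L.Formula (M ⊕ α), Holds p φ ↔ Holds p (φ.relabel (Sum.map σ id))

/-- A global type is an `A`-coheir if each of its formulas is satisfied by a tuple from `A`. -/
def IsCoheir (A : Set M) {α : Type x} (p : GlobalType L M α) : Prop :=
  ∀ φ : L.Formula (M ⊕ α), Holds p φ → ∃ a : α → M, (∀ i, a i ∈ A) ∧ φ.Realize (Sum.elim id a)

variable (L) in
/-- `A` is an invariance base if every type over `A` extends to a global `A`-invariant type. -/
def IsInvarianceBase (A : Set M) : Prop :=
  ∀ (α : Type w) (q : TypeOver L A α), ∃ p : GlobalType L M α,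
    IsInvariantOver A p ∧ restrictParams A p = q

variable (L) in
/-- `b` is invariantly independent from the set `C` over `A`: the type `tp(b/AC)` extends to a
global `A`-invariant type. -/
def InvIndep (A : Set M) {α : Type x} (b : α → M) (C : Set M) : Prop :=
  ∃ p : GlobalType L M α, IsInvariantOver A p ∧ restrictParams (A ∪ C) p = tp L (A ∪ C) b

variable (L) in
/-- `(b_i)_{i < n}` is an invariant sequence over `A`: all `b_i` have the same type over `A`, and
each `b_i` is invariantly independent from `b_{<i}` over `A`. -/
def IsInvariantSequence (A : Set M) {n : ℕ} {α : Type x} (b : Fin n → α → M) : Prop :=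
  (∀ i j, tp L A (b i) = tp L A (b j)) ∧
    ∀ i, InvIndep L A (b i) (⋃ j : {j : Fin n // j < i}, Set.range (b j))

/-- `q(x_0, …, x_{n-1})` is the type over `A` of an invariant sequence. So that this makes sense
also for tuples of variables `x_i` that are too long to be realized in `M`, it is expressed by
finite subtuples: for every finite set `s` of indices, the type of the corresponding subtuples is
realized by an invariant sequence in `M`. If `q` is realized in `M` by an invariant sequence then
this holds (`isInvariantSequenceType_tp`). -/
def IsInvariantSequenceType (A : Set M) {n : ℕ} {α : Type x} (q : TypeOver L A (Fin n × α)) :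
    Prop :=
  ∀ s : Finset α, ∃ b : Fin n → s → M, IsInvariantSequence L A b ∧
    tp L A (fun z : Fin n × s => b z.1 z.2) =
      restrictVars (fun z : Fin n × s => (z.1, (z.2 : α))) q

theorem IsInvariantOver.restrictVars {A : Set M} {α : Type x} {β : Type y} (f : α → β)
    {p : GlobalType L M β} (hp : IsInvariantOver A p) :
    IsInvariantOver A (ReliableTypes.restrictVars f p) := by
  intro σ hσ φ
  rw [holds_restrictVars, holds_restrictVars, hp σ hσ, holds_relabel_relabel,
    holds_relabel_relabel, Sum.map_comp_map, Sum.map_comp_map]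
  rfl

theorem isInvariantSequenceType_tp {A : Set M} {n : ℕ} {α : Type x} {b : Fin n → α → M}
    (hb : IsInvariantSequence L A b) :
    IsInvariantSequenceType A (tp L A (fun z : Fin n × α => b z.1 z.2)) := by
  intro s
  refine ⟨fun i z => b i z, ⟨fun i j => ?_, fun i => ?_⟩, ?_⟩
  · have h := congrArg (restrictVars (fun z : s => (z : α))) (hb.1 i j)
    rw [restrictVars_tp, restrictVars_tp] at h
    exact h
  · obtain ⟨p, hp, h⟩ := hb.2 i
    refine ⟨restrictVars (fun z : s => (z : α)) p, hp.restrictVars _, ?_⟩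
    have h' := congrArg (restrictVars (fun z : s => (z : α))) h
    rw [← restrictParams_restrictVars, restrictVars_tp] at h'
    refine restrictParams_tp_mono (Set.union_subset_union_right _ ?_) h'
    refine Set.iUnion_mono fun j => ?_
    rintro _ ⟨z, rfl⟩
    exact ⟨z, rfl⟩
  · rw [restrictVars_tp]
    rfl

end Invariance

/-! ### Reliability -/

section Reliable

variable (L : FirstOrder.Language.{u, v}) (M : Type w) [L.Structure M] [Nonempty M]

/-- Classes of global types, in arbitrary tuples of variables. -/
abbrev TypeClass := ∀ α : Type w, Set (GlobalType L M α)

variable {L M}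

/-- The class `R` is contained in `I` and has the three closure properties that define
reliability. The inclusion of a tuple of variables `x` in a tuple `xy` is given by an
embedding `f` of index types. -/
structure IsReliableClass (A : Set M) (I R : TypeClass L M) : Prop where
  subset : ∀ α, R α ⊆ I α
  restrict : ∀ (α β : Type w) (f : α ↪ β), ∀ p ∈ R β, restrictVars f p ∈ R α
  extend : ∀ (α β : Type w) (f : α ↪ β), ∀ p ∈ R α, ∀ q : TypeOver L A β,
    restrictVars f q = restrictParams A p →
    ∃ r ∈ R β, restrictVars f r = p ∧ restrictParams A r = q
  sequence : ∀ (α : Type w) (n : ℕ), ∀ p ∈ R α, ∀ q : TypeOver L A (Fin (n + 1) × α),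
    restrictVars (fun z => ((0 : Fin (n + 1)), z)) q = restrictParams A p →
    IsInvariantSequenceType A q →
    ∃ r ∈ R (Fin (n + 1) × α), (∀ i : Fin (n + 1), restrictVars (fun z => (i, z)) r = p) ∧
      restrictParams A r = q

/-- The class of all global types that are reliably in `I` (relative to `A`): the union of all
classes with the defining closure properties. It is the largest such class, see
`isGreatest_reliably`. -/
def Reliably (A : Set M) (I : TypeClass L M) : TypeClass L M :=
  fun α => {p | ∃ R : TypeClass L M, IsReliableClass A I R ∧ p ∈ R α}

theorem isGreatest_reliably (A : Set M) (I : TypeClass L M) :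
    IsGreatest {R : TypeClass L M | IsReliableClass A I R} (Reliably A I) := by
  refine ⟨⟨?_, ?_, ?_, ?_⟩, fun R hR α p hp => ⟨R, hR, hp⟩⟩
  · rintro α p ⟨R, hR, hp⟩
    exact hR.subset α hp
  · rintro α β f p ⟨R, hR, hp⟩
    exact ⟨R, hR, hR.restrict α β f p hp⟩
  · rintro α β f p ⟨R, hR, hp⟩ q hq
    obtain ⟨r, hr, h⟩ := hR.extend α β f p hp q hq
    exact ⟨r, ⟨R, hR, hr⟩, h⟩
  · rintro α n p ⟨R, hR, hp⟩ q hq hs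
    obtain ⟨r, hr, h⟩ := hR.sequence α n p hp q hq hs
    exact ⟨r, ⟨R, hR, hr⟩, h⟩

/-- Reliably `A`-invariant types: those reliably in the class of all `A`-invariant types. -/
def IsReliablyInvariant (A : Set M) {α : Type w} (p : GlobalType L M α) : Prop :=
  p ∈ Reliably A (fun _ => {p | IsInvariantOver A p}) α

/-- Reliable `A`-coheirs: the types reliably in the class of all `A`-coheirs. -/
def IsReliableCoheir (A : Set M) {α : Type w} (p : GlobalType L M α) : Prop :=
  p ∈ Reliably A (fun _ => {p | IsCoheir A p}) α

end Reliable

/-! ### Kim-dividing, Kim-forking, Kim-strict invariance -/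

section Kim

variable {L : FirstOrder.Language.{u, v}} {M : Type w} [L.Structure M] [Nonempty M]

/-- `(e_i)_{i < ω}` is a Morley sequence over `A` generated by the global type `q`:
`e_i` realizes `q ↾ A e_{<i}` for each `i`. -/
def IsMorleySequence (A : Set M) {β : Type x} (q : GlobalType L M β) (e : ℕ → β → M) : Prop :=
  ∀ i, restrictParams (A ∪ ⋃ j : {j : ℕ // j < i}, Set.range (e j)) q =
    tp L (A ∪ ⋃ j : {j : ℕ // j < i}, Set.range (e j)) (e i)

/-- The formula `φ(x, c)` Kim-divides over `A`: there are an `A`-invariant type `q` extending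
`tp(c/A)` and a Morley sequence `(e_i)` over `A` generated by `q` such that
`{φ(x, e_i) : i < ω}` is inconsistent. (Parameters from `A` may be among the `c`.) -/
def KimDivides (A : Set M) {γ : Type x} {m : ℕ} (φ : L.Formula (γ ⊕ Fin m)) (c : Fin m → M) :
    Prop :=
  ∃ q : GlobalType L M (Fin m), IsInvariantOver A q ∧ restrictParams A q = tp L A c ∧
    ∃ e : ℕ → Fin m → M, IsMorleySequence A q e ∧
      ∃ s : Finset ℕ, ¬ ∃ a : γ → M, ∀ i ∈ s, φ.Realize (Sum.elim a (e i))

/-- The formula `φ(x, c)` Kim-forks over `A`: it implies a finite disjunction of formulas each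
of which Kim-divides over `A`. -/
def KimForks (A : Set M) {γ : Type x} {m : ℕ} (φ : L.Formula (γ ⊕ Fin m)) (c : Fin m → M) :
    Prop :=
  ∃ (n : ℕ) (k : Fin n → ℕ) (ψ : ∀ j, L.Formula (γ ⊕ Fin (k j))) (d : ∀ j, Fin (k j) → M),
    (∀ j, KimDivides A (ψ j) (d j)) ∧
      ∀ a : γ → M, φ.Realize (Sum.elim a c) → ∃ j, (ψ j).Realize (Sum.elim a (d j))

variable (L) in
/-- `b` is Kim-independent from the set `C` over `A`: no formula in `tp(b/AC)` Kim-forks over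
`A`. -/
def KimIndep (A : Set M) {γ : Type x} (b : γ → M) (C : Set M) : Prop :=
  ∀ (m : ℕ) (φ : L.Formula (γ ⊕ Fin m)) (c : Fin m → M), (∀ i, c i ∈ A ∪ C) →
    φ.Realize (Sum.elim b c) → ¬ KimForks A φ c

/-- An `A`-invariant type `p` is Kim-strictly `A`-invariant if whenever `a` realizes `p ↾ Ab`, the
tuple `b` is Kim-independent from `a` over `A`. -/
def IsKimStrictlyInvariant (A : Set M) {α : Type w} (p : GlobalType L M α) : Prop :=
  IsInvariantOver A p ∧ ∀ (β : Type w) (b : β → M) (a : α → M),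
    restrictParams (A ∪ Set.range b) p = tp L (A ∪ Set.range b) a →
    KimIndep L A b (Set.range a)

end Kim

end ReliableTypes

open ReliableTypes

/-!
A reliable class is obtained by pruning `I`. A constraint forbids a formula at all finite subtuples
of variables that have a given type over `A`; since `I` is closed and type spaces are compact,
Zorn's lemma yields a maximal set of constraints such that every type over `A` still has an
extension in `I` avoiding all of them. By maximality, a formula occurring at some finite subtuple of
an avoiding type is *unavoidable*: there is a type `Q` over `A`, possibly in more variables, each of
whose avoiding extensions has this formula at some subtuple of the given type. Gluing a copy of `q`
to every such subtuple of `Q` makes the formula unavoidable in extensions of `q`, which by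
compactness gives the second closure property. For the third one, realize an invariant type over
all these subtuples at once: the new tuple then continues the invariant sequence, whichever of the
subtuples has the formula.

An initial segment of a Morley sequence is an invariant sequence, so by the third property a formula
`φ(b, x)` in a reliable type is satisfied along the whole segment by one conjugate of `b`; hence
`φ(y, x)` does not Kim-divide. A formula that Kim-forks is handled by adding the parameters of the
Kim-dividing disjuncts to the type, using the second property.
-/

namespace ReliableTypes

open FirstOrder.Language FirstOrder.Language.Theory

/-! ### Formulas in complete types -/

section Formulas

variable {L : FirstOrder.Language.{u, v}}

section Connectives

variable {C : Type w} {α : Type x} {T : L[[C]].Theory}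

theorem exists_structure_holds_iff (p : T.CompleteType α) :
    ∃ (N : Type (max u v w x)) (_ : L.Structure N) (_ : Nonempty N) (a : C ⊕ α → N),
      (∀ φ : L.Formula (C ⊕ α), Holds p φ ↔ φ.Realize a) ∧
        ∀ ψ : L.Formula C, Formula.equivSentence ψ ∈ T → ψ.Realize (a ∘ Sum.inl) := by
  obtain ⟨N⟩ := p.isMaximal.1
  let _ : L[[C]].Structure N := (L[[C]].lhomWithConstants α).reduct N
  let _ : L.Structure N := (L.lhomWithConstants C).reduct N
  have : (L.lhomWithConstants C).IsExpansionOn N := LHom.isExpansionOn_reduct _ _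
  have : (L[[C]].lhomWithConstants α).IsExpansionOn N := LHom.isExpansionOn_reduct _ _
  refine ⟨N, inferInstance, inferInstance,
    Sum.elim (fun c => (L.con c : N)) (fun a => (L[[C]].con a : N)), fun φ => ?_, fun ψ hψ => ?_⟩
  · rw [← realize_code (C := C) (α := α), p.isMaximal.isComplete.realize_sentence_iff _ N,
      ← p.isMaximal.mem_iff_models]
    rfl
  · have hN : N ⊨ (L[[C]].lhomWithConstants α).onSentence (Formula.equivSentence ψ) :=
      N.is_model.realize_of_mem _ (p.subset ⟨_, hψ, rfl⟩)
    rw [LHom.realize_onSentence] at hN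
    exact (Formula.realize_equivSentence N ψ).1 hN

variable {p q : T.CompleteType α} {φ ψ : L.Formula (C ⊕ α)}

theorem holds_congr
    (h : ∀ (N : Type (max u v w x)) [L.Structure N] (a : C ⊕ α → N), φ.Realize a ↔ ψ.Realize a) :
    Holds p φ ↔ Holds p ψ := by
  obtain ⟨N, _, _, a, ha, -⟩ := exists_structure_holds_iff p
  rw [ha, ha]
  exact h N a

theorem holds_top : Holds p (⊤ : L.Formula (C ⊕ α)) := by
  obtain ⟨N, _, _, a, ha, -⟩ := exists_structure_holds_iff p
  exact (ha _).2 (Formula.realize_top.2 trivial)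

theorem holds_inf : Holds p (φ ⊓ ψ) ↔ Holds p φ ∧ Holds p ψ := by
  obtain ⟨N, _, _, a, ha, -⟩ := exists_structure_holds_iff p
  rw [ha, ha, ha]
  exact Formula.realize_inf

theorem holds_not : Holds p φ.not ↔ ¬ Holds p φ := by
  obtain ⟨N, _, _, a, ha, -⟩ := exists_structure_holds_iff p
  rw [ha, ha]
  exact Formula.realize_not

theorem holds_iff : Holds p (φ.iff ψ) ↔ (Holds p φ ↔ Holds p ψ) := by
  obtain ⟨N, _, _, a, ha, -⟩ := exists_structure_holds_iff p
  rw [ha, ha, ha]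
  exact Formula.realize_iff

theorem eq_of_forall_holds_imp (h : ∀ φ : L.Formula (C ⊕ α), Holds p φ → Holds q φ) : p = q := by
  refine ext_holds fun φ => ⟨h φ, fun hq => ?_⟩
  by_contra hp
  exact holds_not.1 (h _ (holds_not.2 hp)) hq

end Connectives

section Relabel

variable {C : Type w} {α β γ δ : Type*} {T : L[[C]].Theory}

theorem holds_relabel_inf (p : T.CompleteType α) (k : δ → C ⊕ α) {φ ψ : L.Formula δ} :
    Holds p ((φ ⊓ ψ).relabel k) ↔ Holds p (φ.relabel k) ∧ Holds p (ψ.relabel k) := by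
  rw [← holds_inf]
  exact holds_congr fun N _ a => by simp only [Formula.realize_relabel, Formula.realize_inf]

theorem holds_relabel_not (p : T.CompleteType α) (k : δ → C ⊕ α) {φ : L.Formula δ} :
    Holds p (φ.not.relabel k) ↔ ¬ Holds p (φ.relabel k) := by
  rw [← holds_not]
  exact holds_congr fun N _ a => by simp only [Formula.realize_relabel, Formula.realize_not]

theorem holds_relabel_congr {p : T.CompleteType α} {f g : δ → C ⊕ α}
    (h : ∀ z, Holds p (Term.equal (var (f z)) (var (g z)))) (φ : L.Formula δ) :
    Holds p (φ.relabel f) ↔ Holds p (φ.relabel g) := by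
  obtain ⟨N, _, _, a, ha, -⟩ := exists_structure_holds_iff p
  have hfg : a ∘ f = a ∘ g := funext fun z => Formula.realize_equal.1 ((ha _).1 (h z))
  rw [ha, ha, Formula.realize_relabel, Formula.realize_relabel, hfg]

theorem restrictVars_restrictVars (f : α → β) (g : β → γ) (p : T.CompleteType γ) :
    restrictVars f (restrictVars g p) = restrictVars (g ∘ f) p := by
  refine ext_holds fun φ => ?_
  rw [holds_restrictVars, holds_restrictVars, holds_restrictVars, holds_relabel_relabel,
    Sum.map_comp_map, Function.id_comp]

theorem restrictVars_id (p : T.CompleteType α) : restrictVars id p = p := by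
  refine ext_holds fun φ => ?_
  rw [holds_restrictVars]
  exact holds_congr fun N _ a => by rw [Formula.realize_relabel, Sum.map_id_id, Function.comp_id]

end Relabel

section Support

variable {V : Type*}

open Classical in
/-- The finite set of free variables of a formula. -/
noncomputable def support (φ : L.Formula V) : Finset V := BoundedFormula.freeVarFinset φ

open Classical in
/-- A formula, as a formula in its free variables only. -/
noncomputable def core (φ : L.Formula V) : L.Formula (support φ) :=
  BoundedFormula.restrictFreeVar φ id

theorem realize_core {N : Type*} [L.Structure N] (φ : L.Formula V) (a : V → N) :
    (core φ).Realize (a ∘ (↑)) ↔ φ.Realize a := by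
  classical
  exact BoundedFormula.realize_restrictFreeVar a fun _ => rfl

variable {C : Type w} {α β γ : Type*} {T : L[[C]].Theory}

theorem holds_relabel_core (p : T.CompleteType α) (φ : L.Formula V) (k : V → C ⊕ α) :
    Holds p ((core φ).relabel (k ∘ (↑))) ↔ Holds p (φ.relabel k) :=
  holds_congr fun N _ a => by
    rw [Formula.realize_relabel, Formula.realize_relabel, ← Function.comp_assoc, realize_core]

theorem holds_core (p : T.CompleteType α) (φ : L.Formula (C ⊕ α)) :
    Holds p ((core φ).relabel (↑)) ↔ Holds p φ :=
  holds_congr fun N _ a => by rw [Formula.realize_relabel, realize_core]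

theorem exists_fin_formula (φ : L.Formula (C ⊕ α)) :
    ∃ (m : ℕ) (e : Fin m ↪ α) (ψ : L.Formula (C ⊕ Fin m)),
      ∀ p : T.CompleteType α, Holds (restrictVars e p) ψ ↔ Holds p φ := by
  classical
  let s : Finset α := (support φ).preimage Sum.inr Sum.inr_injective.injOn
  let e : Fin s.card ↪ α := s.equivFin.symm.toEmbedding.trans (Function.Embedding.subtype _)
  have h : ∀ z : support φ, ∃ z' : C ⊕ Fin s.card, Sum.map id e z' = (z : C ⊕ α) := by
    rintro ⟨c | z, hz⟩
    · exact ⟨Sum.inl c, rfl⟩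
    · exact ⟨Sum.inr (s.equivFin ⟨z, Finset.mem_preimage.2 hz⟩), by simp [e]⟩
  choose k hk using h
  refine ⟨_, e, (core φ).relabel k, fun p => ?_⟩
  rw [holds_restrictVars, holds_relabel_relabel, ← holds_core p φ]
  exact iff_of_eq (congrArg (fun g => Holds p ((core φ).relabel g)) (funext hk))

theorem restrictVars_eq_of_forall_mem {s : Finset β} {p q : T.CompleteType β}
    (h : restrictVars ((↑) : s → β) p = restrictVars (↑) q) {g : γ → β} (hg : ∀ z, g z ∈ s) :
    restrictVars g p = restrictVars g q := by
  have := congrArg (restrictVars fun z => (⟨g z, hg z⟩ : s)) h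
  rwa [restrictVars_restrictVars, restrictVars_restrictVars] at this

theorem eq_of_forall_finset {p q : T.CompleteType α}
    (h : ∀ s : Finset α, restrictVars ((↑) : s → α) p = restrictVars (↑) q) : p = q := by
  classical
  refine ext_holds fun φ => ?_
  obtain ⟨m, e, ψ, hψ⟩ := exists_fin_formula (T := T) φ
  have he : restrictVars e p = restrictVars e q :=
    restrictVars_eq_of_forall_mem (h (Finset.univ.map e)) fun i => by simp
  rw [← hψ, ← hψ, he]

end Support

end Formulas

/-! ### Compactness of spaces of types -/

section Compactness

variable {L : FirstOrder.Language.{u, v}}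

theorem isClopen_ofPred_holds {C : Type w} {α : Type x} {T : L[[C]].Theory}
    (φ : L.Formula (C ⊕ α)) : IsClopen {p : T.CompleteType α | Holds p φ} :=
  CompleteType.isClopen_typesWith _

theorem isClosed_ofPred_forall {ι : Sort*} {X : Type*} [TopologicalSpace X] {P : ι → X → Prop}
    (h : ∀ i, IsClosed {z | P i z}) : IsClosed {z | ∀ i, P i z} := by
  rw [ofPred_forall]
  exact isClosed_iInter h

theorem continuous_restrictVars {C : Type w} {α : Type x} {β : Type y} {T : L[[C]].Theory}
    (f : α → β) : Continuous (restrictVars f : T.CompleteType β → T.CompleteType α) := by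
  refine continuous_generateFrom_iff.2 ?_
  rintro _ ⟨φ, rfl⟩
  exact CompleteType.isOpen_typesWith ((L[[C]].lhomWithConstantsMap f).onSentence φ)

theorem continuous_restrictParams {M : Type w} [L.Structure M] (A : Set M) {α : Type x} :
    Continuous (restrictParams A : GlobalType L M α → TypeOver L A α) := by
  refine continuous_generateFrom_iff.2 ?_
  rintro _ ⟨φ, rfl⟩
  exact CompleteType.isOpen_typesWith
    (((L.lhomWithConstantsMap ((↑) : A → M)).addConstants α).onSentence φ)

variable {C C' : Type w} {α β ι : Type*} {T : L[[C]].Theory} {T' : L[[C']].Theory}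
  {S : Set (T'.CompleteType β)}

theorem exists_mem_forall_holds_relabel (hS : IsClosed S) (p : T.CompleteType α)
    (k : ι → C ⊕ α → C' ⊕ β)
    (h : ∀ φ, Holds p φ → ∃ r ∈ S, ∀ i, Holds r (φ.relabel (k i))) :
    ∃ r ∈ S, ∀ i φ, Holds p φ → Holds r (φ.relabel (k i)) := by
  let K : {φ // Holds p φ} → Set (T'.CompleteType β) :=
    fun φ => S ∩ {r | ∀ i, Holds r (φ.1.relabel (k i))}
  have hK : ∀ φ, IsClosed (K φ) := fun φ =>
    hS.inter (isClosed_ofPred_forall fun i => (isClopen_ofPred_holds _).isClosed)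
  have : Nonempty {φ // Holds p φ} := ⟨⟨⊤, holds_top⟩⟩
  have hdir : Directed (· ⊇ ·) K := fun φ ψ =>
    ⟨⟨φ.1 ⊓ ψ.1, holds_inf.2 ⟨φ.2, ψ.2⟩⟩,
      fun r hr => ⟨hr.1, fun i => ((holds_relabel_inf r _).1 (hr.2 i)).1⟩,
      fun r hr => ⟨hr.1, fun i => ((holds_relabel_inf r _).1 (hr.2 i)).2⟩⟩
  obtain ⟨r, hr⟩ := IsCompact.nonempty_iInter_of_directed_nonempty_isCompact_isClosed K hdir
    (fun φ => h φ φ.2) (fun φ => (hK φ).isCompact) hK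
  exact ⟨r, (mem_iInter.1 hr ⟨⊤, holds_top⟩).1, fun i φ hφ => (mem_iInter.1 hr ⟨φ, hφ⟩).2 i⟩

theorem exists_mem_forall_restrictVars_eq {S : Set (T.CompleteType β)} (hS : IsClosed S)
    (p : T.CompleteType α) (f : ι → α → β)
    (h : ∀ φ, Holds p φ → ∃ r ∈ S, ∀ i, Holds (restrictVars (f i) r) φ) :
    ∃ r ∈ S, ∀ i, restrictVars (f i) r = p := by
  obtain ⟨r, hrS, hr⟩ := exists_mem_forall_holds_relabel hS p (fun i => Sum.map id (f i))
    (by simpa only [holds_restrictVars] using h)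
  exact ⟨r, hrS, fun i => (eq_of_forall_holds_imp fun φ hφ =>
    (holds_restrictVars _ _ _).2 (hr i φ hφ)).symm⟩

end Compactness

/-! ### Saturation and homogeneity over a set of parameters -/

section TypesOver

variable {L : FirstOrder.Language.{u, v}} {M : Type w} [L.Structure M] {A : Set M}

theorem holds_relabel_inl {α : Type x} (q : TypeOver L A α) (φ : L.Formula A) :
    Holds q (φ.relabel Sum.inl) ↔ φ.Realize ((↑) : A → M) := by
  have of_realize : ∀ ψ : L.Formula A, ψ.Realize ((↑) : A → M) → Holds q (ψ.relabel Sum.inl) := by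
    intro ψ h
    obtain ⟨N, _, _, a, ha, hT⟩ := exists_structure_holds_iff q
    rw [ha, Formula.realize_relabel]
    refine hT ψ ?_
    rw [mem_completeTheory]
    exact (Formula.realize_equivSentence M ψ).2 h
  refine ⟨fun h => ?_, of_realize φ⟩
  by_contra h'
  exact (holds_relabel_not q _).1 (of_realize φ.not h') h

variable [Nonempty M]

theorem tp_eq_iff {α : Type x} {a b : α → M} :
    tp L A a = tp L A b ↔
      ∀ φ : L.Formula (A ⊕ α), φ.Realize (Sum.elim (↑) a) ↔ φ.Realize (Sum.elim (↑) b) := by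
  refine ⟨fun h φ => ?_, fun h => ext_holds fun φ => ?_⟩
  · rw [← holds_tp, h, holds_tp]
  · rw [holds_tp, holds_tp, h]

theorem tp_equiv_comp (σ : M ≃[L] M) (hσ : ∀ a ∈ A, σ a = a) {α : Type x} (c : α → M) :
    tp L A (σ ∘ c) = tp L A c := by
  refine tp_eq_iff.2 fun φ => ?_
  have hcomp : σ ∘ Sum.elim ((↑) : A → M) c = Sum.elim (↑) (σ ∘ c) := by
    rw [Sum.comp_elim]
    exact congrArg (Sum.elim · _) (funext fun a => hσ a a.2)
  rw [← StrongHomClass.realize_formula σ φ (v := Sum.elim _ c), hcomp]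

theorem tp_eq_of_isEmpty {α : Type x} [IsEmpty α] (q : TypeOver L A α) (a : α → M) :
    tp L A a = q := by
  refine ext_holds fun φ => ?_
  have hφ : ∀ r : TypeOver L A α,
      Holds r φ ↔ (φ.relabel (Equiv.sumEmpty A α)).Realize ((↑) : A → M) := fun r => by
    rw [← holds_relabel_inl r, holds_relabel_relabel]
    refine holds_congr fun N _ v => ?_
    rw [Formula.realize_relabel]
    exact iff_of_eq (congrArg _ (funext (Sum.rec (fun _ => rfl) isEmptyElim)))
  rw [hφ, hφ]

theorem exists_realize_of_holds {γ : Type x} {δ : Type y} [Finite δ] {c : γ → M}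
    {q : TypeOver L A (γ ⊕ δ)} (hc : tp L A c = restrictVars Sum.inl q)
    {φ : L.Formula (A ⊕ (γ ⊕ δ))} (hφ : Holds q φ) :
    ∃ b : δ → M, φ.Realize (Sum.elim (↑) (Sum.elim c b)) := by
  have sumElim_assoc : ∀ {N : Type (max u v w x y)} (a : A ⊕ (γ ⊕ δ) → N),
      Sum.elim (a ∘ Sum.map id Sum.inl) (a ∘ Sum.inr ∘ Sum.inr) ∘ (Equiv.sumAssoc A γ δ).symm =
        a := fun a => funext (Sum.rec (fun _ => rfl) (Sum.rec (fun _ => rfl) fun _ => rfl))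
  have hex : Holds (restrictVars Sum.inl q)
      (Formula.iExs δ (φ.relabel (Equiv.sumAssoc A γ δ).symm)) := by
    obtain ⟨N, _, _, a, ha, -⟩ := exists_structure_holds_iff q
    rw [holds_restrictVars, ha, Formula.realize_relabel, Formula.realize_iExs]
    refine ⟨a ∘ Sum.inr ∘ Sum.inr, ?_⟩
    rwa [Formula.realize_relabel, sumElim_assoc, ← ha]
  rw [← hc, holds_tp, Formula.realize_iExs] at hex
  obtain ⟨b, hb⟩ := hex
  refine ⟨b, ?_⟩
  rw [Formula.realize_relabel] at hb
  convert hb using 1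
  exact funext (Sum.rec (fun _ => rfl) (Sum.rec (fun _ => rfl) fun _ => rfl))

theorem holds_relabel_iff_realize {B : Set M} {α : Type x} {p : GlobalType L M α} {a : α → M}
    (hp : restrictParams B p = tp L B a) {V : Type*} (φ : L.Formula V) (k : V → M ⊕ α)
    (hk : ∀ z ∈ support φ, ∀ m, k z = Sum.inl m → m ∈ B) :
    Holds p (φ.relabel k) ↔ φ.Realize (Sum.elim id a ∘ k) := by
  have hlift : ∀ z : support φ, ∃ z' : B ⊕ α, Sum.map (↑) id z' = k z := by
    rintro ⟨z, hz⟩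
    rcases hkz : k z with m | i
    · exact ⟨Sum.inl ⟨m, hk z hz m hkz⟩, rfl⟩
    · exact ⟨Sum.inr i, rfl⟩
  choose k' hk' using hlift
  have hcomp : Sum.map (↑) id ∘ k' = k ∘ ((↑) : support φ → V) := funext hk'
  rw [← holds_relabel_core, ← hcomp, ← holds_relabel_relabel, ← holds_restrictParams, hp, holds_tp,
    Formula.realize_relabel, ← realize_core φ, Function.comp_assoc, ← hcomp,
    ← Function.comp_assoc, Sum.elim_comp_map, Function.id_comp, Function.comp_id]

end TypesOver

section Saturation

variable (L : FirstOrder.Language.{u, v}) {M : Type w} [L.Structure M] [Nonempty M] (A : Set M)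

/-- All types in one variable over `A` together with finitely many further parameters are
realized. Over a small set this is what remains of the saturation of a monster model. -/
def IsSaturatedOver : Prop :=
  ∀ F : Set M, F.Finite → ∀ q : TypeOver L (A ∪ F) (Fin 1), ∃ b : Fin 1 → M, tp L (A ∪ F) b = q

/-- Finite tuples with the same type over `A` are conjugate under `Aut(M/A)`. Over a small set this
is what remains of the strong homogeneity of a monster model. -/
def IsHomogeneousOver : Prop :=
  ∀ (n : ℕ) (c d : Fin n → M), tp L A c = tp L A d →
    ∃ σ : M ≃[L] M, (∀ a ∈ A, σ a = a) ∧ ∀ i, σ (c i) = d i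

variable {L A} {κ : Cardinal.{w}}

omit [Nonempty M] in
theorem mk_union_lt_of_finite (hκ : ℵ₀ < κ) (hA : #A < κ) {F : Set M} (hF : F.Finite) :
    #(A ∪ F : Set M) < κ :=
  (mk_union_le _ _).trans_lt (add_lt_of_lt hκ.le hA ((lt_aleph0_iff_finite.2 hF).trans hκ))

theorem IsMonster.isSaturatedOver (hM : IsMonster L M κ) (hA : #A < κ) : IsSaturatedOver L A :=
  fun F hF => hM.saturated (A ∪ F) (mk_union_lt_of_finite hM.uncountable hA hF)

theorem IsMonster.isHomogeneousOver (hM : IsMonster L M κ) (hA : #A < κ) :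
    IsHomogeneousOver L A := by
  intro n c d h
  let c' : A ⊕ Fin n → M := Sum.elim (↑) c
  let d' : A ⊕ Fin n → M := Sum.elim (↑) d
  have hrange : ∀ b : (A ∪ range c : Set M), ∃ z, c' z = b := by
    rintro ⟨b, hb | ⟨i, rfl⟩⟩
    · exact ⟨Sum.inl ⟨b, hb⟩, rfl⟩
    · exact ⟨Sum.inr i, rfl⟩
  choose t ht using hrange
  have hwell : ∀ z z', c' z = c' z' → d' z = d' z' := fun z z' hz => Formula.realize_equal.1
    ((tp_eq_iff.1 h (Term.equal (var z) (var z'))).1 (Formula.realize_equal.2 hz))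
  obtain ⟨σ, hσ⟩ := hM.homogeneous (A ∪ range c) (d' ∘ t)
    (mk_union_lt_of_finite hM.uncountable hA (finite_range c)) fun φ => by
      rw [← Formula.realize_relabel, ← show c' ∘ t = (↑) from funext ht, ← Formula.realize_relabel]
      exact tp_eq_iff.1 h (φ.relabel t)
  exact ⟨σ, fun a ha => (hσ ⟨a, Or.inl ha⟩).trans (hwell _ (Sum.inl ⟨a, ha⟩) (ht _)),
    fun i => (hσ ⟨c i, Or.inr ⟨i, rfl⟩⟩).trans (hwell _ (Sum.inr i) (ht _))⟩

theorem IsHomogeneousOver.exists_equiv (hh : IsHomogeneousOver L A) {γ : Type x} [Finite γ]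
    {c d : γ → M} (h : tp L A c = tp L A d) :
    ∃ σ : M ≃[L] M, (∀ a ∈ A, σ a = a) ∧ σ ∘ c = d := by
  obtain ⟨n, ⟨e⟩⟩ := Finite.exists_equiv_fin γ
  obtain ⟨σ, hσA, hσ⟩ := hh n (c ∘ e.symm) (d ∘ e.symm) (by
    rw [← restrictVars_tp, h, restrictVars_tp])
  exact ⟨σ, hσA, funext fun i => by simpa using hσ (e i)⟩

theorem IsSaturatedOver.union (hs : IsSaturatedOver L A) {F : Set M} (hF : F.Finite) :
    IsSaturatedOver L (A ∪ F) := fun F' hF' => by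
  rw [union_assoc]
  exact hs _ (hF.union hF')

theorem IsSaturatedOver.exists_tp_sumElim_eq (hs : IsSaturatedOver L A) {γ : Type x} [Finite γ]
    {c : γ → M} {q : TypeOver L A (γ ⊕ Fin 1)} (hc : tp L A c = restrictVars Sum.inl q) :
    ∃ b : Fin 1 → M, tp L A (Sum.elim c b) = q := by
  let k : A ⊕ (γ ⊕ Fin 1) → (A ∪ range c : Set M) ⊕ Fin 1 :=
    Sum.elim (fun a => Sum.inl ⟨a, Or.inl a.2⟩)
      (Sum.map (fun i => ⟨c i, Or.inr (mem_range_self i)⟩) id)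
  have hk : ∀ b : Fin 1 → M, Sum.elim (↑) b ∘ k = Sum.elim (↑) (Sum.elim c b) := fun b =>
    funext (Sum.rec (fun _ => rfl) (Sum.rec (fun _ => rfl) fun _ => rfl))
  obtain ⟨t, -, ht⟩ := exists_mem_forall_holds_relabel
    (T' := L[[(A ∪ range c : Set M)]].completeTheory M) isClosed_univ q (fun _ : Unit => k)
    fun φ hφ => by
      obtain ⟨b, hb⟩ := exists_realize_of_holds hc hφ
      refine ⟨tp L _ b, mem_univ _, fun _ => ?_⟩
      rwa [holds_tp, Formula.realize_relabel, hk]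
  obtain ⟨b, rfl⟩ := hs (range c) (finite_range c) t
  refine ⟨b, (eq_of_forall_holds_imp fun φ hφ => ?_).symm⟩
  have := ht () φ hφ
  rwa [holds_tp, Formula.realize_relabel, hk, ← holds_tp] at this

theorem exists_tp_eq_of_equiv {γ δ : Type x} (e : γ ≃ δ)
    (h : ∀ q : TypeOver L A γ, ∃ c, tp L A c = q) (q : TypeOver L A δ) : ∃ d, tp L A d = q := by
  obtain ⟨c, hc⟩ := h (restrictVars e q)
  refine ⟨c ∘ e.symm, ?_⟩
  rw [← restrictVars_tp, hc, restrictVars_restrictVars, Equiv.self_comp_symm, restrictVars_id]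

theorem IsSaturatedOver.exists_tp_eq (hs : IsSaturatedOver L A) {γ : Type x} [Finite γ]
    (q : TypeOver L A γ) : ∃ c : γ → M, tp L A c = q := by
  induction γ using Finite.induction_empty_option with
  | of_equiv e ih => exact exists_tp_eq_of_equiv e ih q
  | h_empty => exact ⟨isEmptyElim, tp_eq_of_isEmpty q _⟩
  | @h_option γ _ ih =>
    let e : γ ⊕ Fin 1 ≃ Option γ :=
      ((Equiv.refl γ).sumCongr (Equiv.ofUnique _ _)).trans (Equiv.optionEquivSumPUnit.{0} γ).symm
    refine exists_tp_eq_of_equiv e (fun q => ?_) q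
    obtain ⟨c, hc⟩ := ih (restrictVars Sum.inl q)
    obtain ⟨b, hb⟩ := hs.exists_tp_sumElim_eq hc
    exact ⟨Sum.elim c b, hb⟩

theorem IsSaturatedOver.exists_tp_comp_eq (hs : IsSaturatedOver L A) {β : Type x}
    (q : TypeOver L A β) (s : Finset β) :
    ∃ c : β → M, tp L A (c ∘ ((↑) : s → β)) = restrictVars (↑) q := by
  classical
  obtain ⟨c, hc⟩ := hs.exists_tp_eq (restrictVars ((↑) : s → β) q)
  refine ⟨fun z => if h : z ∈ s then c ⟨z, h⟩ else Classical.arbitrary M, ?_⟩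
  rw [← hc]
  exact congrArg (tp L A) (funext fun z => dif_pos z.2)

theorem exists_comp_eq_and_tp_eq (hs : IsSaturatedOver L A) (hh : IsHomogeneousOver L A)
    {γ : Type x} {δ : Type y} [Finite γ] {h : γ → δ} {c : γ → M} {q : TypeOver L A δ}
    (hc : tp L A c = restrictVars h q) (t : Finset δ) :
    ∃ d : δ → M, d ∘ h = c ∧ tp L A (d ∘ ((↑) : t → δ)) = restrictVars (↑) q := by
  classical
  obtain ⟨d, hd⟩ := hs.exists_tp_comp_eq q (t ∪ (finite_range h).toFinset)
  rw [← restrictVars_tp] at hd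
  have hdh : tp L A (d ∘ h) = tp L A c := by
    rw [hc, ← restrictVars_tp]
    exact restrictVars_eq_of_forall_mem hd (by simp)
  obtain ⟨σ, hσA, hσ⟩ := hh.exists_equiv hdh
  refine ⟨σ ∘ d, hσ, ?_⟩
  rw [Function.comp_assoc, tp_equiv_comp σ hσA, ← restrictVars_tp]
  exact restrictVars_eq_of_forall_mem hd fun z => Finset.mem_union_left _ z.2

theorem exists_realize_iff_holds (hs : IsSaturatedOver L A) (hh : IsHomogeneousOver L A)
    {γ : Type x} [Finite γ] {r : GlobalType L M γ} {e : γ → M}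
    (hr : restrictParams A r = tp L A e) {β ι : Type*} [Finite ι] (b : β → M)
    (Φ : ι → L.Formula (β ⊕ γ)) :
    ∃ b' : β → M, ∀ i,
      (Φ i).Realize (Sum.elim b' e) ↔ Holds r ((Φ i).relabel (Sum.map b id)) := by
  let F : Set M := ⋃ i, b '' (Sum.inl ⁻¹' (support (Φ i) : Set (β ⊕ γ)))
  have hF : F.Finite := finite_iUnion fun i =>
    ((support (Φ i)).finite_toSet.preimage Sum.inl_injective.injOn).image b
  obtain ⟨e', he'⟩ := (hs.union hF).exists_tp_eq (restrictParams (A ∪ F) r)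
  obtain ⟨σ, -, rfl⟩ := hh.exists_equiv
    ((restrictParams_tp_mono subset_union_left he'.symm).symm.trans hr)
  refine ⟨σ ∘ b, fun i => ?_⟩
  rw [holds_relabel_iff_realize he'.symm (Φ i), ← Sum.comp_elim, StrongHomClass.realize_formula σ,
    Sum.elim_comp_map, Function.id_comp, Function.comp_id]
  rintro (z | z) hz m hm
  · obtain rfl := Sum.inl_injective hm
    exact Or.inr (mem_iUnion.2 ⟨i, z, hz, rfl⟩)
  · cases hm

end Saturation

/-! ### Amalgamation of types over a set of parameters -/

section Gluing

/-- The inclusion, as the copy with label `x`, of the variables `δ` in those obtained from the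
variables `β` by adjoining, for each label in `G`, a copy of `δ`. The subtuple `h` of the copy with
label `x` is identified with the subtuple `g` of `β`. -/
noncomputable def glueCopy {β γ δ G : Type*} (h : γ ↪ δ) (g : γ ↪ β) (x : G) :
    δ ↪ β ⊕ (G × ↥(range h)ᶜ) :=
  open Classical in
  (Equiv.Set.sumCompl (range h)).symm.toEmbedding.trans
    (((Equiv.ofInjective h h.injective).symm.toEmbedding.trans g).sumMap
      (Function.Embedding.sectR x _))

variable {β γ δ G N : Type*} (h : γ ↪ δ) (g : γ ↪ β) (x : G)

theorem glueCopy_apply (c : γ) : glueCopy h g x (h c) = Sum.inl (g c) := by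
  classical
  simp [glueCopy, Equiv.Set.sumCompl_symm_apply_of_mem (mem_range_self c)]

theorem glueCopy_apply_compl (z : ↥(range h)ᶜ) : glueCopy h g x z = Sum.inr (x, z) := by
  classical
  simp [glueCopy, Equiv.Set.sumCompl_symm_apply_compl]

variable {h g x}

theorem sumElim_comp_glueCopy {a : β → N} {d : G → δ → N} (hd : d x ∘ h = a ∘ g) :
    Sum.elim a (fun z : G × ↥(range h)ᶜ => d z.1 z.2) ∘ glueCopy h g x = d x := by
  funext z
  rcases em (z ∈ range h) with ⟨c, rfl⟩ | hz
  · rw [Function.comp_apply, glueCopy_apply]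
    exact (congrFun hd c).symm
  · rw [Function.comp_apply, glueCopy_apply_compl h g x ⟨z, hz⟩]
    rfl

end Gluing

section Amalgamation

variable {L : FirstOrder.Language.{u, v}}

theorem isClosed_ofPred_restrictVars_eq {C : Type w} {α : Type x} {β : Type y} {T : L[[C]].Theory}
    (f : α → β) (q : T.CompleteType α) :
    IsClosed {p : T.CompleteType β | restrictVars f p = q} :=
  isClosed_singleton.preimage (continuous_restrictVars f)

theorem exists_restrictVars_eq {C : Type w} {T : L[[C]].Theory} {β δ V G : Type*}
    {i : β → V} {Q : T.CompleteType β} {e : G → δ → V} {q : T.CompleteType δ}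
    (h : ∀ (s : Finset β) (Γ : Finset G) (t : Finset δ), ∃ Q' : T.CompleteType V,
      restrictVars (i ∘ ((↑) : s → β)) Q' = restrictVars (↑) Q ∧
        ∀ g ∈ Γ, restrictVars (e g ∘ ((↑) : t → δ)) Q' = restrictVars (↑) q) :
    ∃ Q' : T.CompleteType V, restrictVars i Q' = Q ∧ ∀ g, restrictVars (e g) Q' = q := by
  classical
  let K : Finset β × Finset G × Finset δ → Set (T.CompleteType V) := fun j =>
    {Q' | restrictVars ((↑) : j.1 → β) (restrictVars i Q') = restrictVars (↑) Q ∧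
      ∀ g ∈ j.2.1, restrictVars ((↑) : j.2.2 → δ) (restrictVars (e g) Q') = restrictVars (↑) q}
  have hclosed : ∀ j, IsClosed (K j) := fun j => by
    simp only [K, restrictVars_restrictVars]
    exact (isClosed_ofPred_restrictVars_eq _ _).inter (isClosed_ofPred_forall fun g =>
      isClosed_ofPred_forall fun _ => isClosed_ofPred_restrictVars_eq _ _)
  have hanti : Antitone K := fun j j' hj Q' hQ' =>
    ⟨restrictVars_eq_of_forall_mem hQ'.1 fun z => hj.1 z.2,
      fun g hg => restrictVars_eq_of_forall_mem (hQ'.2 g (hj.2.1 hg)) fun z => hj.2.2 z.2⟩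
  obtain ⟨Q', hQ'⟩ := IsCompact.nonempty_iInter_of_directed_nonempty_isCompact_isClosed K
    hanti.directed_ge
    (fun j => by
      obtain ⟨Q', hQ'⟩ := h j.1 j.2.1 j.2.2
      exact ⟨Q', by simpa only [K, mem_ofPred_eq, restrictVars_restrictVars] using hQ'⟩)
    (fun j => (hclosed j).isCompact) hclosed
  rw [mem_iInter] at hQ'
  exact ⟨Q', eq_of_forall_finset fun s => (hQ' (s, ∅, ∅)).1,
    fun g => eq_of_forall_finset fun t => (hQ' (∅, {g}, t)).2 g (Finset.mem_singleton_self g)⟩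

variable {M : Type w} [L.Structure M] [Nonempty M] {A : Set M}

theorem IsSaturatedOver.exists_tp_comp_eq_of_finite (hs : IsSaturatedOver L A) {γ : Type x}
    [Finite γ] {β : Type y} (Q : TypeOver L A β) (s : Finset β) (Γ : Finset (γ → β)) :
    ∃ a : β → M, tp L A (a ∘ ((↑) : s → β)) = restrictVars (↑) Q ∧
      ∀ g ∈ Γ, tp L A (a ∘ g) = restrictVars g Q := by
  classical
  have := Fintype.ofFinite γ
  obtain ⟨a, ha⟩ := hs.exists_tp_comp_eq Q (s ∪ Γ.biUnion fun g => Finset.univ.image g)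
  simp only [← restrictVars_tp] at ha ⊢
  refine ⟨a, restrictVars_eq_of_forall_mem ha fun z => Finset.mem_union_left _ z.2,
    fun g hg => restrictVars_eq_of_forall_mem ha fun z => Finset.mem_union_right _ ?_⟩
  exact Finset.mem_biUnion.2 ⟨g, hg, Finset.mem_image_of_mem g (Finset.mem_univ z)⟩

theorem exists_attach (hs : IsSaturatedOver L A) (hh : IsHomogeneousOver L A) {γ : Type}
    [Finite γ] {β δ : Type w} (Q : TypeOver L A β) (q : TypeOver L A δ) (h : γ ↪ δ) :
    ∃ (V : Type w) (i : β ↪ V) (Q' : TypeOver L A V), restrictVars i Q' = Q ∧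
      ∀ g : γ ↪ β, restrictVars g Q = restrictVars h q →
        ∃ e : δ ↪ V, (∀ c, e (h c) = i (g c)) ∧ restrictVars e Q' = q := by
  classical
  let G : Type w := {g : γ ↪ β // restrictVars g Q = restrictVars h q}
  obtain ⟨Q', hQ, hq⟩ := exists_restrictVars_eq (T := L[[A]].completeTheory M) (i := Sum.inl)
    (Q := Q) (e := fun g : G => glueCopy h g.1 g) (q := q) fun s Γ t => by
      obtain ⟨a, ha, haΓ⟩ := hs.exists_tp_comp_eq_of_finite Q s (Γ.image fun g : G => (g.1 : γ → β))
      have hd : ∀ g : G, ∃ d : δ → M, g ∈ Γ →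
          d ∘ h = a ∘ g.1 ∧ tp L A (d ∘ ((↑) : t → δ)) = restrictVars (↑) q := by
        intro g
        by_cases hg : g ∈ Γ
        · obtain ⟨d, hd⟩ := exists_comp_eq_and_tp_eq hs hh
            ((haΓ _ (Finset.mem_image_of_mem _ hg)).trans g.2) t
          exact ⟨d, fun _ => hd⟩
        · exact ⟨fun _ => Classical.arbitrary M, fun hg' => absurd hg' hg⟩
      choose d hd using hd
      refine ⟨tp L A (Sum.elim a fun z : G × ↥(range h)ᶜ => d z.1 z.2), ?_, fun g hg => ?_⟩
      · rw [restrictVars_tp, ← Function.comp_assoc, Sum.elim_comp_inl, ha]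
      · rw [restrictVars_tp, ← Function.comp_assoc, sumElim_comp_glueCopy (hd g hg).1, (hd g hg).2]
  exact ⟨_, Function.Embedding.inl, Q', hQ,
    fun g hg => ⟨glueCopy h g ⟨g, hg⟩, glueCopy_apply h g _, hq ⟨g, hg⟩⟩⟩

theorem IsInvariantOver.tp_sumElim_eq (hh : IsHomogeneousOver L A) {γ : Type x} [Finite γ]
    {δ : Type y} {p : GlobalType L M δ} (hp : IsInvariantOver A p) {c c' : γ → M} {b b' : δ → M}
    (hc : tp L A c = tp L A c') (hb : restrictParams (A ∪ range c) p = tp L _ b)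
    (hb' : restrictParams (A ∪ range c') p = tp L _ b') :
    tp L A (Sum.elim c b) = tp L A (Sum.elim c' b') := by
  obtain ⟨σ, hσA, rfl⟩ := hh.exists_equiv hc
  let k : (γ → M) → A ⊕ (γ ⊕ δ) → M ⊕ δ := fun c => Sum.elim (Sum.inl ∘ (↑)) (Sum.map c id)
  have realize_iff : ∀ {c : γ → M} {b : δ → M}, restrictParams (A ∪ range c) p = tp L _ b →
      ∀ φ, Holds (tp L A (Sum.elim c b)) φ ↔ Holds p (φ.relabel (k c)) := by
    intro c b hb φ
    have hk : Sum.elim id b ∘ k c = Sum.elim (↑) (Sum.elim c b) :=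
      funext (Sum.rec (fun _ => rfl) (Sum.rec (fun _ => rfl) fun _ => rfl))
    rw [holds_tp, holds_relabel_iff_realize hb φ, hk]
    rintro (z | z | z) - m hm
    · exact Or.inl (Sum.inl_injective hm ▸ z.2)
    · exact Or.inr (Sum.inl_injective hm ▸ mem_range_self z)
    · cases hm
  have hσk : Sum.map σ id ∘ k c = k (σ ∘ c) := funext (Sum.rec
    (fun a => congrArg Sum.inl (hσA a a.2)) (Sum.rec (fun _ => rfl) fun _ => rfl))
  refine ext_holds fun φ => ?_
  rw [realize_iff hb, hp σ hσA, holds_relabel_relabel, hσk, realize_iff hb']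

theorem exists_add_of_invIndep (hs : IsSaturatedOver L A) (hh : IsHomogeneousOver L A)
    {γ δ : Type} [Finite γ] [Finite δ] {c : γ → M} {b : δ → M} (hb : InvIndep L A b (range c))
    {β : Type w} (Q : TypeOver L A β) :
    ∃ Q' : TypeOver L A (β ⊕ δ), restrictVars Sum.inl Q' = Q ∧
      ∀ g : γ → β, restrictVars g Q = tp L A c →
        restrictVars (Sum.map g id) Q' = tp L A (Sum.elim c b) := by
  classical
  obtain ⟨p, hp, hpb⟩ := hb
  let G : Type w := {g : γ → β // restrictVars g Q = tp L A c}
  obtain ⟨Q', hQ, hq⟩ := exists_restrictVars_eq (T := L[[A]].completeTheory M)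
    (i := (Sum.inl : β → β ⊕ δ)) (Q := Q) (e := fun g : G => Sum.map g.1 id)
    (q := tp L A (Sum.elim c b)) fun s Γ t => by
      have := Fintype.ofFinite γ
      obtain ⟨a, ha, haΓ⟩ := hs.exists_tp_comp_eq_of_finite Q s (Γ.image fun g : G => (g.1 : γ → β))
      let s' : Finset β := Γ.biUnion fun g => Finset.univ.image g.1
      obtain ⟨d, hd⟩ := (hs.union (s'.finite_toSet.image a)).exists_tp_eq (restrictParams _ p)
      refine ⟨tp L A (Sum.elim a d), ?_, fun g hg => ?_⟩
      · rw [restrictVars_tp, ← Function.comp_assoc, Sum.elim_comp_inl, ha]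
      · have hgs : A ∪ range (a ∘ g.1) ⊆ A ∪ a '' s' := union_subset_union_right A <| by
          rintro _ ⟨z, rfl⟩
          exact mem_image_of_mem a (Finset.mem_coe.2 (Finset.mem_biUnion.2
            ⟨g, hg, Finset.mem_image_of_mem _ (Finset.mem_univ z)⟩))
        have hag : tp L A c = tp L A (a ∘ g.1) :=
          ((haΓ _ (Finset.mem_image_of_mem _ hg)).trans g.2).symm
        rw [← restrictVars_restrictVars, restrictVars_tp _ (Sum.map _ _), Sum.elim_comp_map,
          Function.comp_id,
          hp.tp_sumElim_eq hh hag hpb (restrictParams_tp_mono hgs hd.symm)]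
  exact ⟨Q', hQ, fun g hg => hq ⟨g, hg⟩⟩

end Amalgamation

/-! ### Unavoidable properties of types in a class -/

section InvariantSequences

variable {L : FirstOrder.Language.{u, v}} {M : Type w} [L.Structure M] [Nonempty M] {A : Set M}
  {α : Type x} {β : Type y}

theorem InvIndep.mono {b : α → M} {C D : Set M} (h : C ⊆ D) (hb : InvIndep L A b D) :
    InvIndep L A b C := by
  obtain ⟨p, hp, hpb⟩ := hb
  exact ⟨p, hp, restrictParams_tp_mono (union_subset_union_right A h) hpb⟩

theorem InvIndep.comp {b : β → M} {C : Set M} (f : α → β) (hb : InvIndep L A b C) :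
    InvIndep L A (b ∘ f) C := by
  obtain ⟨p, hp, hpb⟩ := hb
  refine ⟨restrictVars f p, hp.restrictVars f, ?_⟩
  rw [restrictParams_restrictVars, hpb, restrictVars_tp]

variable {n : ℕ}

theorem IsInvariantSequence.comp {b : Fin n → β → M} (f : α → β)
    (hb : IsInvariantSequence L A b) : IsInvariantSequence L A (fun i => b i ∘ f) := by
  refine ⟨fun i j => ?_, fun i => ((hb.2 i).comp f).mono ?_⟩
  · rw [← restrictVars_tp, ← restrictVars_tp, hb.1 i j]
  · exact iUnion_mono fun j => range_comp_subset_range _ _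

theorem IsInvariantSequence.init {b : Fin (n + 1) → α → M} (hb : IsInvariantSequence L A b) :
    IsInvariantSequence L A (fun i : Fin n => b i.castSucc) := by
  refine ⟨fun i j => hb.1 _ _, fun i => (hb.2 i.castSucc).mono (iUnion_subset fun j => ?_)⟩
  exact subset_iUnion (fun j : {j : Fin (n + 1) // j < i.castSucc} => range (b j))
    ⟨j.1.castSucc, Fin.castSucc_lt_castSucc_iff.2 j.2⟩

theorem IsInvariantSequence.invIndep_last {b : Fin (n + 1) → α → M}
    (hb : IsInvariantSequence L A b) :
    InvIndep L A (b (Fin.last n)) (range fun z : Fin n × α => b z.1.castSucc z.2) := by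
  refine (hb.2 (Fin.last n)).mono ?_
  rintro _ ⟨⟨j, z⟩, rfl⟩
  exact mem_iUnion.2 ⟨⟨j.castSucc, Fin.castSucc_lt_last j⟩, z, rfl⟩

theorem IsInvariantSequenceType.exists_comp_embedding [Finite α]
    {q : TypeOver L A (Fin n × β)} (hq : IsInvariantSequenceType A q) (e : α ↪ β) :
    ∃ b : Fin n → α → M, IsInvariantSequence L A b ∧
      tp L A (fun z : Fin n × α => b z.1 z.2) = restrictVars (Prod.map id e) q := by
  classical
  have := Fintype.ofFinite α
  obtain ⟨b, hb, hbq⟩ := hq (Finset.univ.map e)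
  let e' : α → ↥(Finset.univ.map e) := fun z => ⟨e z, by simp⟩
  refine ⟨fun i => b i ∘ e', hb.comp e', ?_⟩
  have h := congrArg (restrictVars (Prod.map id e')) hbq
  rwa [restrictVars_tp, restrictVars_restrictVars] at h

end InvariantSequences

section Unavoidable

variable {L : FirstOrder.Language.{u, v}} {M : Type w} [L.Structure M]

/-- The class `R` is closed under subtuples. -/
def ClosedUnderSubtuples (R : TypeClass L M) : Prop :=
  ∀ (α β : Type w) (f : α ↪ β), ∀ p ∈ R β, restrictVars f p ∈ R α

variable (A : Set M) (R : TypeClass L M)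

/-- The types in the class `R` extending a given type over `A`. -/
def extensions {α : Type w} (q : TypeOver L A α) : Set (GlobalType L M α) :=
  {p | p ∈ R α ∧ restrictParams A p = q}

/-- Every type over `A` extends to a type in `R`. -/
def HasExtensions : Prop :=
  ∀ (α : Type w) (q : TypeOver L A α), (extensions A R q).Nonempty

/-- The property `P` is unavoidable at `q` if there is a type over `A` (possibly in more variables)
such that every extension of it in `R` has the property `P` at some subtuple of its variables whose
type over `A` is `q`. -/
def IsUnavoidable {δ : Type x} (q : TypeOver L A δ) (P : Set (GlobalType L M δ)) : Prop :=
  ∃ (β : Type w) (Q : TypeOver L A β), ∀ p ∈ extensions A R Q,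
    ∃ g : δ ↪ β, restrictVars g Q = q ∧ restrictVars g p ∈ P

/-- Each formula that holds at some finite subtuple of the variables of a type in `R` is unavoidable
at the type of this subtuple over `A`. -/
def HasUnavoidableFormulas : Prop :=
  ∀ (α : Type w), ∀ p ∈ R α, ∀ (m : ℕ) (e : Fin m ↪ α) (ψ : L.Formula (M ⊕ Fin m)),
    Holds (restrictVars e p) ψ → IsUnavoidable A R (restrictVars e (restrictParams A p))
      {r | Holds r ψ}

variable {A R}

theorem restrictVars_mem_extensions (hR : ClosedUnderSubtuples R) {β V : Type w} (i : β ↪ V)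
    {Q : TypeOver L A V} {p : GlobalType L M V} (hp : p ∈ extensions A R Q) :
    restrictVars i p ∈ extensions A R (restrictVars i Q) := by
  refine ⟨hR _ _ i p hp.1, ?_⟩
  rw [restrictParams_restrictVars, hp.2]

theorem IsUnavoidable.exists_mem (hR : ClosedUnderSubtuples R) (hex : HasExtensions A R)
    {δ : Type w} {q : TypeOver L A δ} {P : Set (GlobalType L M δ)} (h : IsUnavoidable A R q P) :
    ∃ r ∈ extensions A R q, r ∈ P := by
  obtain ⟨β, Q, hQ⟩ := h
  obtain ⟨p, hp⟩ := hex β Q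
  obtain ⟨g, rfl, hgp⟩ := hQ p hp
  exact ⟨_, restrictVars_mem_extensions hR g hp, hgp⟩

theorem IsUnavoidable.of_forall_exists (hR : ClosedUnderSubtuples R) {β : Type w} {δ : Type x}
    {Q : TypeOver L A β} {P' : Set (GlobalType L M β)} (hQ : IsUnavoidable A R Q P')
    {q : TypeOver L A δ} {P : Set (GlobalType L M δ)}
    (h : ∀ r ∈ extensions A R Q, r ∈ P' →
      ∃ g : δ ↪ β, restrictVars g Q = q ∧ restrictVars g r ∈ P) :
    IsUnavoidable A R q P := by
  obtain ⟨V, Q', hQ'⟩ := hQ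
  refine ⟨V, Q', fun p hp => ?_⟩
  obtain ⟨e, rfl, hep⟩ := hQ' p hp
  obtain ⟨g, hg, hgp⟩ := h _ (restrictVars_mem_extensions hR e hp) hep
  rw [restrictVars_restrictVars] at hg hgp
  exact ⟨g.trans e, hg, hgp⟩

theorem IsUnavoidable.comap {γ : Type x} {δ : Type y} (e : γ ↪ δ) {q : TypeOver L A δ}
    {P : Set (GlobalType L M δ)} (hP : IsUnavoidable A R q P) {P' : Set (GlobalType L M γ)}
    (h : ∀ r ∈ P, restrictVars e r ∈ P') :
    IsUnavoidable A R (restrictVars e q) P' := by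
  obtain ⟨β, Q, hQ⟩ := hP
  refine ⟨β, Q, fun p hp => ?_⟩
  obtain ⟨g, rfl, hgp⟩ := hQ p hp
  refine ⟨e.trans g, (restrictVars_restrictVars e g Q).symm, ?_⟩
  have := h _ hgp
  rwa [restrictVars_restrictVars] at this

variable [Nonempty M]

theorem IsUnavoidable.of_restrictVars (hs : IsSaturatedOver L A) (hh : IsHomogeneousOver L A)
    (hR : ClosedUnderSubtuples R) {γ : Type} [Finite γ] {δ : Type w} {q : TypeOver L A δ}
    {h : γ ↪ δ} {P : Set (GlobalType L M γ)} (hP : IsUnavoidable A R (restrictVars h q) P) :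
    IsUnavoidable A R q {r | restrictVars h r ∈ P} := by
  obtain ⟨β, Q, hQ⟩ := hP
  obtain ⟨V, i, Q', rfl, hattach⟩ := exists_attach hs hh Q q h
  refine ⟨V, Q', fun p hp => ?_⟩
  obtain ⟨g, hg, hgp⟩ := hQ _ (restrictVars_mem_extensions hR i hp)
  obtain ⟨e, he, heQ⟩ := hattach g hg
  have hei : e ∘ h = i ∘ g := funext he
  refine ⟨e, heQ, ?_⟩
  rwa [mem_ofPred_eq, restrictVars_restrictVars, hei, ← restrictVars_restrictVars]

theorem IsUnavoidable.sumElim (hs : IsSaturatedOver L A) (hh : IsHomogeneousOver L A)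
    (hR : ClosedUnderSubtuples R) (hex : HasExtensions A R) {γ δ : Type} [Finite γ] [Finite δ]
    {a : γ → M} {b : δ → M} (hba : InvIndep L A b (range a)) {P : Set (GlobalType L M γ)}
    {P' : Set (GlobalType L M δ)} (ha : IsUnavoidable A R (tp L A a) P)
    (hb : IsUnavoidable A R (tp L A b) P') :
    IsUnavoidable A R (tp L A (Sum.elim a b))
      {r | restrictVars Sum.inl r ∈ P ∧
        restrictVars Sum.inr r ∈ P'} := by
  obtain ⟨β, Q, hQ⟩ := ha
  obtain ⟨Q₂, rfl, hadd⟩ := exists_add_of_invIndep hs hh hba Q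
  have hinr : restrictVars Sum.inr Q₂ = tp L A b := by
    obtain ⟨p, hp⟩ := hex _ (restrictVars Sum.inl Q₂)
    obtain ⟨f, hf, -⟩ := hQ p hp
    have h := congrArg (restrictVars Sum.inr) (hadd f hf)
    rwa [restrictVars_restrictVars, restrictVars_tp, Sum.elim_comp_inr] at h
  have hb' : IsUnavoidable A R Q₂
      {r | restrictVars Function.Embedding.inr r ∈ P'} :=
    of_restrictVars hs hh hR (h := Function.Embedding.inr) (hinr ▸ hb)
  refine hb'.of_forall_exists hR fun r hr hrP => ?_
  obtain ⟨f, hf, hfr⟩ := hQ _ (restrictVars_mem_extensions hR Function.Embedding.inl hr)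
  refine ⟨f.sumMap (Function.Embedding.refl δ), hadd f hf, ?_, ?_⟩
  · rw [restrictVars_restrictVars] at hfr ⊢
    exact hfr
  · rw [restrictVars_restrictVars]
    exact hrP

/-- The variables of a sequence of `n + 1` tuples, split into those of the first `n` tuples and
those of the last one. -/
def snocEquiv (n : ℕ) (γ : Type x) : Fin (n + 1) × γ ≃ (Fin n × γ) ⊕ γ :=
  (finSumFinEquiv.symm.prodCongr (Equiv.refl γ)).trans
    ((Equiv.sumProdDistrib _ _ _).trans ((Equiv.refl _).sumCongr (Equiv.uniqueProd γ (Fin 1))))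

theorem snocEquiv_castSucc {n : ℕ} {γ : Type x} (j : Fin n) (z : γ) :
    snocEquiv n γ (j.castSucc, z) = Sum.inl (j, z) := by
  simp [snocEquiv]

theorem snocEquiv_last {n : ℕ} {γ : Type x} (z : γ) :
    snocEquiv n γ (Fin.last n, z) = Sum.inr z := by
  simp [snocEquiv]

theorem IsUnavoidable.sequence (hs : IsSaturatedOver L A) (hh : IsHomogeneousOver L A)
    (hR : ClosedUnderSubtuples R) (hex : HasExtensions A R) {γ : Type} [Finite γ]
    {q : TypeOver L A γ} {P : Set (GlobalType L M γ)} (hP : IsUnavoidable A R q P) {n : ℕ}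
    {b : Fin n → γ → M} (hb : IsInvariantSequence L A b) (hbq : ∀ i, tp L A (b i) = q) :
    IsUnavoidable A R (tp L A fun z : Fin n × γ => b z.1 z.2)
      {r | ∀ i, restrictVars (fun z => (i, z)) r ∈ P} := by
  induction n with
  | zero =>
    refine ⟨PEmpty, tp L A PEmpty.elim, fun p _ => ⟨Function.Embedding.ofIsEmpty, ?_, Fin.rec0⟩⟩
    rw [restrictVars_tp, tp_eq_of_isEmpty]
  | succ n ih =>
    have hsnoc := (ih hb.init fun i => hbq i.castSucc).sumElim hs hh hR hex hb.invIndep_last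
      (hbq (Fin.last n) ▸ hP)
    have htp : tp L A (fun z : Fin (n + 1) × γ => b z.1 z.2) =
        restrictVars (snocEquiv n γ).toEmbedding
          (tp L A (Sum.elim (fun z => b z.1.castSucc z.2) (b (Fin.last n)))) := by
      rw [restrictVars_tp]
      refine congrArg _ (funext fun ⟨j, z⟩ => ?_)
      induction j using Fin.lastCases with
      | last => simp [snocEquiv_last]
      | cast j => simp [snocEquiv_castSucc]
    rw [htp]
    refine hsnoc.comap _ fun r hr j => ?_
    rw [restrictVars_restrictVars]
    induction j using Fin.lastCases with
    | last =>
      convert hr.2 using 2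
      exact funext fun z => snocEquiv_last z
    | cast j =>
      have hj := hr.1 j
      rw [restrictVars_restrictVars] at hj
      convert hj using 2
      exact funext fun z => snocEquiv_castSucc j z

theorem exists_mem_extensions_restrictVars_eq (hs : IsSaturatedOver L A)
    (hh : IsHomogeneousOver L A) (hR : ClosedUnderSubtuples R) (hex : HasExtensions A R)
    (hun : HasUnavoidableFormulas A R) {α β : Type w} {p : GlobalType L M α} (hp : p ∈ R α)
    {f : α ↪ β} {q : TypeOver L A β} (hcl : IsClosed (extensions A R q))
    (hq : restrictVars f q = restrictParams A p) :
    ∃ r ∈ extensions A R q, restrictVars f r = p := by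
  obtain ⟨r, hr, hrp⟩ := exists_mem_forall_restrictVars_eq hcl p (fun _ : Unit => f) fun φ hφ => by
    obtain ⟨m, e, ψ, hψ⟩ := exists_fin_formula (T := L.elementaryDiagram M) φ
    have hun' : IsUnavoidable A R (restrictVars (e.trans f) q) {r | Holds r ψ} := by
      have := hun α p hp m e ψ ((hψ p).2 hφ)
      rwa [← hq, restrictVars_restrictVars] at this
    obtain ⟨r, hr, hrψ⟩ := (hun'.of_restrictVars hs hh hR).exists_mem hR hex
    refine ⟨r, hr, fun _ => ?_⟩
    rwa [← hψ, restrictVars_restrictVars]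
  exact ⟨r, hr, hrp ()⟩

theorem exists_mem_extensions_forall_restrictVars_eq (hs : IsSaturatedOver L A)
    (hh : IsHomogeneousOver L A) (hR : ClosedUnderSubtuples R) (hex : HasExtensions A R)
    (hun : HasUnavoidableFormulas A R) {α : Type w} {n : ℕ} {p : GlobalType L M α} (hp : p ∈ R α)
    {q : TypeOver L A (Fin (n + 1) × α)} (hcl : IsClosed (extensions A R q))
    (hq : restrictVars (fun z => (0, z)) q = restrictParams A p)
    (hqs : IsInvariantSequenceType A q) :
    ∃ r ∈ extensions A R q, ∀ i, restrictVars (fun z => (i, z)) r = p := by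
  refine exists_mem_forall_restrictVars_eq hcl p (fun i z => (i, z)) fun φ hφ => ?_
  obtain ⟨m, e, ψ, hψ⟩ := exists_fin_formula (T := L.elementaryDiagram M) φ
  obtain ⟨b, hb, hbq⟩ := hqs.exists_comp_embedding e
  have hb0 : tp L A (b 0) = restrictVars e (restrictParams A p) := by
    have h := congrArg (restrictVars fun z => ((0 : Fin (n + 1)), z)) hbq
    rw [restrictVars_tp, restrictVars_restrictVars] at h
    rw [← hq, restrictVars_restrictVars]
    exact h
  have hseq := (hun α p hp m e ψ ((hψ p).2 hφ)).sequence hs hh hR hex hb fun i =>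
    (hb.1 i 0).trans hb0
  rw [hbq] at hseq
  obtain ⟨r, hr, hrψ⟩ := (IsUnavoidable.of_restrictVars hs hh hR
    (h := (Function.Embedding.refl (Fin (n + 1))).prodMap e) hseq).exists_mem hR hex
  refine ⟨r, hr, fun i => ?_⟩
  have h := hrψ i
  rw [restrictVars_restrictVars] at h
  rwa [← hψ, restrictVars_restrictVars]

theorem isReliableClass_of_hasUnavoidableFormulas (hs : IsSaturatedOver L A)
    (hh : IsHomogeneousOver L A) {I : TypeClass L M} (hRI : ∀ α, R α ⊆ I α)
    (hR : ClosedUnderSubtuples R) (hex : HasExtensions A R)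
    (hcl : ∀ (α : Type w) (q : TypeOver L A α), IsClosed (extensions A R q))
    (hun : HasUnavoidableFormulas A R) : IsReliableClass A I R where
  subset := hRI
  restrict := hR
  extend α β f p hp q hq := by
    obtain ⟨r, hr, hrp⟩ :=
      exists_mem_extensions_restrictVars_eq hs hh hR hex hun hp (hcl β q) hq
    exact ⟨r, hr.1, hrp, hr.2⟩
  sequence α n p hp q hq hqs := by
    obtain ⟨r, hr, hrp⟩ :=
      exists_mem_extensions_forall_restrictVars_eq hs hh hR hex hun hp (hcl _ q) hq hqs
    exact ⟨r, hr.1, hrp, hr.2⟩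

end Unavoidable

/-! ### Maximal sets of avoidable constraints -/

section Avoidance

variable {L : FirstOrder.Language.{u, v}} {M : Type w} [L.Structure M]

variable (L) in
/-- A constraint forbids the formula `formula` at the finite subtuples of variables that have the
type `type` over `A`. -/
structure Constraint (A : Set M) where
  arity : ℕ
  type : TypeOver L A (Fin arity)
  formula : L.Formula (M ⊕ Fin arity)

variable {A : Set M}

/-- The global type `p` avoids a constraint if it contains the forbidden formula at no subtuple of
its variables to which the constraint applies. -/
def Avoids {α : Type x} (p : GlobalType L M α) (k : Constraint L A) : Prop :=
  ∀ g : Fin k.arity ↪ α,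
    restrictVars g (restrictParams A p) = k.type → ¬ Holds (restrictVars g p) k.formula

/-- The types in `I` that avoid all constraints in `F`. -/
def avoiding (I : TypeClass L M) (F : Set (Constraint L A)) : TypeClass L M :=
  fun α => {p | p ∈ I α ∧ ∀ k ∈ F, Avoids p k}

theorem Avoids.restrictVars {α : Type x} {β : Type y} (f : α ↪ β) {p : GlobalType L M β}
    {k : Constraint L A} (h : Avoids p k) : Avoids (ReliableTypes.restrictVars f p) k := by
  intro g hg
  rw [restrictParams_restrictVars, restrictVars_restrictVars] at hg
  rw [restrictVars_restrictVars]
  exact h (g.trans f) hg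

variable {I : TypeClass L M}

theorem ClosedUnderSubtuples.avoiding (hI : ClosedUnderSubtuples I) (F : Set (Constraint L A)) :
    ClosedUnderSubtuples (avoiding I F) :=
  fun α β f p hp => ⟨hI α β f p hp.1, fun k hk => (hp.2 k hk).restrictVars f⟩

theorem extensions_avoiding_anti {F F' : Set (Constraint L A)} (h : F ⊆ F') {α : Type w}
    (q : TypeOver L A α) : extensions A (avoiding I F') q ⊆ extensions A (avoiding I F) q :=
  fun _ hp => ⟨⟨hp.1.1, fun k hk => hp.1.2 k (h hk)⟩, hp.2⟩

theorem isClosed_extensions_avoiding (hI : ∀ α, IsClosed (I α)) (F : Set (Constraint L A))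
    {α : Type w} (q : TypeOver L A α) : IsClosed (extensions A (avoiding I F) q) := by
  have heq : extensions A (avoiding I F) q = (I α ∩ restrictParams A ⁻¹' {q}) ∩
      {p | ∀ k ∈ F, ∀ g : Fin k.arity ↪ α,
        restrictVars g q = k.type → ¬ Holds (restrictVars g p) k.formula} := by
    ext p
    constructor
    · rintro ⟨⟨hpI, hpF⟩, rfl⟩
      exact ⟨⟨hpI, rfl⟩, hpF⟩
    · rintro ⟨⟨hpI, rfl⟩, hpF⟩
      exact ⟨⟨hpI, hpF⟩, rfl⟩
  rw [heq]
  refine ((hI α).inter (isClosed_singleton.preimage (continuous_restrictParams A))).inter ?_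
  exact isClosed_ofPred_forall fun k => isClosed_ofPred_forall fun _ =>
    isClosed_ofPred_forall fun g => isClosed_ofPred_forall fun _ =>
      (isClopen_ofPred_holds k.formula).compl.isClosed.preimage (continuous_restrictVars g)

theorem hasExtensions_avoiding_sUnion (hI : ∀ α, IsClosed (I α))
    {c : Set (Set (Constraint L A))} (hc : ∀ F ∈ c, HasExtensions A (avoiding I F))
    (hchain : IsChain (· ⊆ ·) c) (hne : c.Nonempty) :
    HasExtensions A (avoiding I (⋃₀ c)) := by
  intro α q
  have : Nonempty c := hne.to_subtype
  have hdir : Directed (· ⊇ ·) fun F : c => extensions A (avoiding I F.1) q := fun F F' =>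
    (hchain.total F.2 F'.2).elim
      (fun h => ⟨F', extensions_avoiding_anti h q, subset_rfl⟩)
      (fun h => ⟨F, subset_rfl, extensions_avoiding_anti h q⟩)
  obtain ⟨p, hp⟩ := IsCompact.nonempty_iInter_of_directed_nonempty_isCompact_isClosed _ hdir
    (fun F => hc F F.2 α q) (fun F => (isClosed_extensions_avoiding hI F.1 q).isCompact)
    (fun F => isClosed_extensions_avoiding hI F.1 q)
  have hp : ∀ F ∈ c, p ∈ extensions A (avoiding I F) q := fun F hF => mem_iInter.1 hp ⟨F, hF⟩
  obtain ⟨F₀, hF₀⟩ := hne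
  refine ⟨p, ⟨(hp F₀ hF₀).1.1, ?_⟩, (hp F₀ hF₀).2⟩
  rintro k ⟨F, hF, hk⟩
  exact (hp F hF).1.2 k hk

theorem exists_maximal_hasExtensions_avoiding (hI : ∀ α, IsClosed (I α))
    (hex : HasExtensions A I) :
    ∃ F : Set (Constraint L A), Maximal (fun F => HasExtensions A (avoiding I F)) F := by
  have hempty : HasExtensions A (avoiding I (∅ : Set (Constraint L A))) := fun α q => by
    simpa [extensions, avoiding] using hex α q
  obtain ⟨F, -, hF⟩ := zorn_subset_nonempty {F | HasExtensions A (avoiding I F)}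
    (fun c hc hchain hne => ⟨⋃₀ c, hasExtensions_avoiding_sUnion hI hc hchain hne,
      fun F hF => subset_sUnion_of_mem hF⟩) ∅ hempty
  exact ⟨F, hF⟩

theorem hasExtensions_avoiding_insert {F : Set (Constraint L A)} {k : Constraint L A}
    (hk : ¬ IsUnavoidable A (avoiding I F) k.type {r | Holds r k.formula}) :
    HasExtensions A (avoiding I (insert k F)) := by
  intro β Q
  simp only [IsUnavoidable, not_exists, not_forall, not_and, mem_ofPred_eq] at hk
  obtain ⟨p, hp, hpk⟩ := hk β Q
  refine ⟨p, ⟨hp.1.1, ?_⟩, hp.2⟩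
  rintro k' (rfl | hk')
  · exact fun g hg => hpk g (hp.2 ▸ hg)
  · exact hp.1.2 k' hk'

theorem hasUnavoidableFormulas_avoiding {F : Set (Constraint L A)}
    (hF : Maximal (fun F => HasExtensions A (avoiding I F)) F) :
    HasUnavoidableFormulas A (avoiding I F) := by
  intro α p hp m e ψ hψ
  by_contra hun
  let k : Constraint L A := ⟨m, restrictVars e (restrictParams A p), ψ⟩
  have hkF : k ∈ F :=
    hF.2 (hasExtensions_avoiding_insert (k := k) hun) (subset_insert k F) (mem_insert k F)
  exact hp.2 k hkF e rfl hψ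

theorem HasExtensions.reliably [Nonempty M] (hs : IsSaturatedOver L A)
    (hh : IsHomogeneousOver L A) (hsub : ClosedUnderSubtuples I) (hcl : ∀ α, IsClosed (I α))
    (hex : HasExtensions A I) : HasExtensions A (Reliably A I) := by
  obtain ⟨F, hF⟩ := exists_maximal_hasExtensions_avoiding hcl hex
  have hrel : IsReliableClass A I (avoiding I F) :=
    isReliableClass_of_hasUnavoidableFormulas hs hh (fun α p hp => hp.1) (hsub.avoiding F) hF.1
      (fun α q => isClosed_extensions_avoiding hcl F q) (hasUnavoidableFormulas_avoiding hF)
  intro α q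
  obtain ⟨p, hp, hpq⟩ := hF.1 α q
  exact ⟨p, ⟨avoiding I F, hrel, hp⟩, hpq⟩

end Avoidance

/-! ### Kim-strictness of reliable types -/

section KimStrict

theorem exists_sumElim_id_eq {M : Type w} {A : Set M} {α : Type x} (a : α → M) {c : M}
    (hc : c ∈ A ∪ range a) :
    ∃ t : M ⊕ α, Sum.elim id a t = c ∧ ∀ m, t = Sum.inl m → m ∈ A := by
  rcases hc with hc | ⟨z, hz⟩
  · exact ⟨Sum.inl c, rfl, by rintro _ ⟨⟩; exact hc⟩
  · exact ⟨Sum.inr z, hz, fun _ h => nomatch h⟩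

variable {L : FirstOrder.Language.{u, v}} {M : Type w} [L.Structure M] [Nonempty M] {A : Set M}

theorem IsMorleySequence.isInvariantSequence {β : Type x} {q : GlobalType L M β}
    (hq : IsInvariantOver A q) {e : ℕ → β → M} (he : IsMorleySequence A q e) (n : ℕ) :
    IsInvariantSequence L A (fun i : Fin n => e i) := by
  refine ⟨fun i j => (restrictParams_tp_mono subset_union_left (he i)).symm.trans
    (restrictParams_tp_mono subset_union_left (he j)), fun i => ?_⟩
  have h : InvIndep L A (e i) (⋃ j : {j : ℕ // j < i}, range (e j)) := ⟨q, hq, he i⟩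
  refine h.mono (iUnion_subset fun j => ?_)
  exact subset_iUnion (fun j : {j : ℕ // j < i} => range (e j)) ⟨j, j.2⟩

theorem holds_equal_of_restrictParams_eq {B : Set M} {α : Type x} {p : GlobalType L M α}
    {a : α → M} (hp : restrictParams B p = tp L B a) {s t : M ⊕ α}
    (hs : ∀ m, s = Sum.inl m → m ∈ B) (ht : ∀ m, t = Sum.inl m → m ∈ B)
    (h : Sum.elim id a s = Sum.elim id a t) :
    Holds p (Term.equal (var s) (var t) : L.Formula (M ⊕ α)) := by
  have hst := (holds_relabel_iff_realize hp (Term.equal (var true) (var false))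
    (fun z => cond z s t) (Bool.rec (fun _ => ht) fun _ => hs)).2 (Formula.realize_equal.2 h)
  refine (holds_congr fun N _ v => ?_).1 hst
  rw [Formula.realize_relabel, Formula.realize_equal, Formula.realize_equal]
  rfl

variable {I R : TypeClass L M} {γ : Type x}

theorem IsReliableClass.exists_forall_realize (hs : IsSaturatedOver L A)
    (hh : IsHomogeneousOver L A) (hR : IsReliableClass A I R) {α : Type w} [Finite α]
    {r : GlobalType L M α} (hr : r ∈ R α) {n : ℕ} {e : Fin (n + 1) → α → M}
    (he : IsInvariantSequence L A e) (hre : restrictParams A r = tp L A (e 0))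
    {ψ : L.Formula (γ ⊕ α)} {b : γ → M} (hψ : Holds r (ψ.relabel (Sum.map b id))) :
    ∃ b' : γ → M, ∀ i, ψ.Realize (Sum.elim b' (e i)) := by
  obtain ⟨r', -, hr'r, hr'A⟩ := hR.sequence α n r hr (tp L A fun z => e z.1 z.2)
    (by rw [restrictVars_tp, hre]; rfl) (isInvariantSequenceType_tp he)
  obtain ⟨b', hb'⟩ := exists_realize_iff_holds hs hh hr'A b
    fun i : Fin (n + 1) => ψ.relabel (Sum.map id fun z => (i, z))
  refine ⟨b', fun i => ?_⟩
  have hi : Holds r' ((ψ.relabel (Sum.map id fun z => (i, z))).relabel (Sum.map b id)) := by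
    rw [← hr'r i, holds_restrictVars, holds_relabel_relabel, Sum.map_comp_map] at hψ
    rwa [holds_relabel_relabel, Sum.map_comp_map]
  have := (hb' i).2 hi
  rwa [Formula.realize_relabel, Sum.elim_comp_map] at this

theorem IsReliableClass.not_kimDivides (hs : IsSaturatedOver L A) (hh : IsHomogeneousOver L A)
    (hR : IsReliableClass A I R) {α : Type w} {r : GlobalType L M α} (hr : r ∈ R α) {k : ℕ}
    (f : Fin k ↪ α) {d : Fin k → M} (hrd : restrictVars f (restrictParams A r) = tp L A d)
    {ψ : L.Formula (γ ⊕ Fin k)} {b : γ → M} (hψ : Holds r (ψ.relabel (Sum.map b f))) :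
    ¬ KimDivides A ψ d := by
  rintro ⟨q, hq, hqd, e, he, s, hs'⟩
  have hr₀ := hR.restrict _ _ (Equiv.ulift.{w}.toEmbedding.trans f) r hr
  have he₀ : restrictVars f (restrictParams A r) = tp L A (e 0) :=
    hrd.trans (hqd.symm.trans (restrictParams_tp_mono subset_union_left (he 0)))
  obtain ⟨b', hb'⟩ := hR.exists_forall_realize hs hh hr₀ (n := s.sup id) (b := b)
    (ψ := ψ.relabel (Sum.map id ULift.up)) ((he.isInvariantSequence hq _).comp ULift.down)
    (by
      rw [restrictParams_restrictVars, ← restrictVars_tp]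
      exact (restrictVars_restrictVars (ULift.down : ULift.{w} (Fin k) → Fin k) f _).symm.trans
        (congrArg (restrictVars ULift.down) he₀))
    (by rwa [holds_restrictVars, holds_relabel_relabel, holds_relabel_relabel, Sum.map_comp_map,
      Sum.map_comp_map])
  refine hs' ⟨b', fun i hi => ?_⟩
  have := hb' ⟨i, Nat.lt_succ_of_le (Finset.le_sup (f := id) hi)⟩
  rwa [Formula.realize_relabel, Sum.elim_comp_map] at this

theorem IsReliableClass.not_kimForks (hs : IsSaturatedOver L A) (hh : IsHomogeneousOver L A)
    (hR : IsReliableClass A I R) {α : Type w} {r : GlobalType L M α} (hr : r ∈ R α) {m : ℕ}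
    (f : Fin m ↪ α) {c : Fin m → M} (hrc : restrictVars f (restrictParams A r) = tp L A c)
    {φ : L.Formula (γ ⊕ Fin m)} {b : γ → M} (hφ : Holds r (φ.relabel (Sum.map b f))) :
    ¬ KimForks A φ c := by
  rintro ⟨n, k, ψ, d, hdiv, himp⟩
  let V := ULift.{w} (Fin m) ⊕ ULift.{w} (Σ j, Fin (k j))
  let e : V → M := Sum.elim (c ∘ ULift.down) (fun z => d z.down.1 z.down.2)
  let oldVars : Fin m ↪ V := Equiv.ulift.symm.toEmbedding.trans .inl
  let newVars (j : Fin n) : Fin (k j) ↪ V :=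
    (Function.Embedding.sigmaMk (β := fun j => Fin (k j)) j).trans
      (Equiv.ulift.symm.toEmbedding.trans .inr)
  obtain ⟨r', hr', hr'r, hr'A⟩ := hR.extend _ V .inl _
    (hR.restrict _ _ (Equiv.ulift.{w}.toEmbedding.trans f) r hr) (tp L A e) (by
      rw [restrictParams_restrictVars, restrictVars_tp]
      exact ((restrictVars_restrictVars _ _ _).symm.trans
        ((congrArg (restrictVars ULift.down) hrc).trans (restrictVars_tp A _ c))).symm)
  have hφ' : Holds r' (φ.relabel (Sum.map b oldVars)) := by
    have h := congrArg (restrictVars ULift.up) hr'r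
    rw [restrictVars_restrictVars, restrictVars_restrictVars] at h
    have h' := congrArg (Holds · (φ.relabel (Sum.map b id))) h
    simp only [holds_restrictVars, holds_relabel_relabel, Sum.map_comp_map] at h'
    exact h'.mpr hφ
  obtain ⟨b', hb'⟩ := exists_realize_iff_holds hs hh hr'A b fun o : Option (Fin n) =>
    o.elim (φ.relabel (Sum.map id oldVars)) fun j => (ψ j).relabel (Sum.map id (newVars j))
  simp only [Option.forall, Option.elim_none, Option.elim_some, Formula.realize_relabel,
    holds_relabel_relabel, Sum.elim_comp_map, Sum.map_comp_map] at hb'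
  obtain ⟨j, hj⟩ := himp b' (hb'.1.2 hφ')
  refine hR.not_kimDivides hs hh hr' (newVars j) ?_ ((hb'.2 j).1 hj) (hdiv j)
  rw [hr'A, restrictVars_tp]
  rfl

theorem IsReliableClass.kimIndep (hs : IsSaturatedOver L A) (hh : IsHomogeneousOver L A)
    (hR : IsReliableClass A I R) {α : Type w} {p : GlobalType L M α} (hp : p ∈ R α) {b : γ → M}
    {a : α → M} (hpa : restrictParams (A ∪ range b) p = tp L (A ∪ range b) a) :
    KimIndep L A b (range a) := by
  intro m φ c hc hφ
  have hp' : restrictParams A p = tp L A a := restrictParams_tp_mono subset_union_left hpa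
  obtain ⟨r, hr, hrp, hrA⟩ := hR.extend α (α ⊕ ULift.{w} (Fin m)) .inl p hp
    (tp L A (Sum.elim a (c ∘ ULift.down))) (by rw [restrictVars_tp, hp']; rfl)
  let f : Fin m ↪ α ⊕ ULift.{w} (Fin m) := Equiv.ulift.symm.toEmbedding.trans .inr
  choose t htc htA using fun i => exists_sumElim_id_eq a (hc i)
  have hpφ : Holds p (φ.relabel (Sum.elim (Sum.inl ∘ b) t)) := by
    rw [holds_relabel_iff_realize hpa]
    · have htc' : Sum.elim id a ∘ t = c := funext htc
      rwa [Sum.comp_elim, htc']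
    · rintro (z | i) - m' h
      · exact Or.inr ⟨z, Sum.inl_injective h⟩
      · exact Or.inl (htA i m' h)
  have hrt : Holds r (φ.relabel (Sum.map id Sum.inl ∘ Sum.elim (Sum.inl ∘ b) t)) := by
    rw [← hrp, holds_restrictVars, holds_relabel_relabel] at hpφ
    exact hpφ
  refine hR.not_kimForks hs hh hr f ?_ (b := b) ((holds_relabel_congr ?_ φ).1 hrt)
  · rw [hrA, restrictVars_tp]
    rfl
  · rintro (z | i)
    · exact (holds_congr fun N _ v => by simp [Formula.realize_equal]).2 holds_top
    · refine holds_equal_of_restrictParams_eq hrA ?_ (fun _ h => nomatch h) (Eq.trans ?_ (htc i))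
      · change ∀ m', Sum.map id Sum.inl (t i) = Sum.inl m' → m' ∈ A
        cases hti : t i with
        | inl m' => rintro _ ⟨⟩; exact htA i m' hti
        | inr z => exact fun _ h => nomatch h
      · change Sum.elim id (Sum.elim a _) (Sum.map id Sum.inl (t i)) = _
        cases t i <;> rfl

theorem IsReliablyInvariant.isKimStrictlyInvariant (hs : IsSaturatedOver L A)
    (hh : IsHomogeneousOver L A) {α : Type w} {p : GlobalType L M α}
    (hp : IsReliablyInvariant A p) : IsKimStrictlyInvariant A p := by
  obtain ⟨R, hR, hpR⟩ := hp
  exact ⟨hR.subset α hpR, fun β b a h => hR.kimIndep hs hh hpR h⟩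

end KimStrict

/-! ### Invariant types and coheirs -/

section Coheir

variable {L : FirstOrder.Language.{u, v}} {M : Type w} [L.Structure M]

theorem isClosed_ofPred_isInvariantOver (A : Set M) (α : Type x) :
    IsClosed {p : GlobalType L M α | IsInvariantOver A p} := by
  refine isClosed_ofPred_forall fun σ => isClosed_ofPred_forall fun _ =>
    isClosed_ofPred_forall fun φ => ?_
  simp only [← holds_iff]
  exact (isClopen_ofPred_holds _).1

theorem isClosed_ofPred_isCoheir (A : Set M) (α : Type x) :
    IsClosed {p : GlobalType L M α | IsCoheir A p} := by
  refine isClosed_ofPred_forall fun φ => ?_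
  by_cases h : ∃ a : α → M, (∀ i, a i ∈ A) ∧ φ.Realize (Sum.elim id a)
  · simp only [h, implies_true]
    exact isClosed_univ
  · simp only [h, imp_false]
    exact (isClopen_ofPred_holds φ).2.isClosed_compl

theorem IsCoheir.isInvariantOver {A : Set M} {α : Type x} {p : GlobalType L M α}
    (hp : IsCoheir A p) : IsInvariantOver A p := by
  intro σ hσ φ
  rw [← holds_iff]
  by_contra h
  obtain ⟨a, ha, hφ⟩ := hp _ (holds_not.2 h)
  have hσa : σ ∘ Sum.elim id a = Sum.elim id a ∘ Sum.map σ id := by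
    funext z
    rcases z with z | z
    · rfl
    · exact hσ _ (ha z)
  rw [Formula.realize_not, Formula.realize_iff, Formula.realize_relabel, ← hσa,
    StrongHomClass.realize_formula] at hφ
  exact hφ Iff.rfl

theorem IsCoheir.restrictVars {A : Set M} {α : Type x} {β : Type y} (f : α → β)
    {p : GlobalType L M β} (hp : IsCoheir A p) : IsCoheir A (ReliableTypes.restrictVars f p) := by
  intro φ hφ
  rw [holds_restrictVars] at hφ
  obtain ⟨a, ha, hφa⟩ := hp _ hφ
  rw [Formula.realize_relabel, Sum.elim_comp_map] at hφa
  exact ⟨a ∘ f, fun i => ha _, hφa⟩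

theorem closedUnderSubtuples_isCoheir (A : Set M) :
    ClosedUnderSubtuples fun α => {p : GlobalType L M α | IsCoheir A p} :=
  fun _ _ f _ hp => IsCoheir.restrictVars f hp

variable [Nonempty M]

theorem closedUnderSubtuples_isInvariantOver (A : Set M) :
    ClosedUnderSubtuples fun α => {p : GlobalType L M α | IsInvariantOver A p} :=
  fun _ _ f _ hp => IsInvariantOver.restrictVars f hp

theorem holds_typeOf {α : Type x} (a : α → M) (φ : L.Formula (M ⊕ α)) :
    Holds ((L.elementaryDiagram M).typeOf a) φ ↔ φ.Realize (Sum.elim id a) := by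
  unfold Holds
  rw [CompleteType.formula_mem_typeOf]
  unfold Formula.Realize
  rw [← BoundedFormula.realize_constantsVarsEquiv, Equiv.apply_symm_apply]
  rfl

theorem exists_realize_of_holds_elementarySubstructure (N : L.ElementarySubstructure M)
    {α : Type x} {q : TypeOver L (N : Set M) α} {φ : L.Formula ((N : Set M) ⊕ α)}
    (hφ : Holds q φ) : ∃ a : α → N, φ.Realize (Sum.elim (fun c => (c : M)) fun i => (a i : M)) := by
  obtain ⟨m, e, ψ, hψ⟩ := exists_fin_formula (T := L[[(N : Set M)]].completeTheory M) φ
  have hex : Holds q ((Formula.iExs (Fin m) ψ).relabel Sum.inl) := by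
    have h := (hψ q).2 hφ
    obtain ⟨N', _, _, a, ha, -⟩ := exists_structure_holds_iff q
    rw [holds_restrictVars, ha, Formula.realize_relabel] at h
    rw [ha, Formula.realize_relabel, Formula.realize_iExs]
    refine ⟨fun i => a (Sum.inr (e i)), (iff_of_eq (congrArg _ ?_)).1 h⟩
    funext z
    rcases z with z | z <;> rfl
  rw [holds_relabel_inl] at hex
  have hexN : (Formula.iExs (Fin m) ψ).Realize (id : N → N) :=
    (N.subtype.map_formula (Formula.iExs (Fin m) ψ) id).1 hex
  obtain ⟨c, hc⟩ := Formula.realize_iExs.1 hexN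
  let a : α → N := Function.extend e c fun _ => Classical.arbitrary N
  have hae : a ∘ e = c := Function.extend_comp e.injective c _
  refine ⟨a, (holds_tp (N : Set M) (fun i => (a i : M)) φ).1 ((hψ _).1 ?_)⟩
  rw [restrictVars_tp, holds_tp]
  convert (N.subtype.map_formula ψ _).2 hc using 1
  rw [Sum.comp_elim, ← hae]
  rfl

theorem exists_isCoheir (N : L.ElementarySubstructure M) {α : Type x}
    (q : TypeOver L (N : Set M) α) : ∃ p : GlobalType L M α,
      IsCoheir (N : Set M) p ∧ restrictParams (N : Set M) p = q := by
  obtain ⟨p, hp, hpq⟩ := exists_mem_forall_holds_relabel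
    (isClosed_ofPred_isCoheir (L := L) (N : Set M) α) q
    (fun _ : Unit => Sum.map (fun c : (N : Set M) => (c : M)) id) fun φ hφ => by
      obtain ⟨a, ha⟩ := exists_realize_of_holds_elementarySubstructure N hφ
      refine ⟨(L.elementaryDiagram M).typeOf fun i => (a i : M), fun θ hθ =>
        ⟨_, fun i => (a i).2, (holds_typeOf _ θ).1 hθ⟩, fun _ => ?_⟩
      rw [holds_typeOf, Formula.realize_relabel, Sum.elim_comp_map]
      exact ha
  refine ⟨p, hp, (eq_of_forall_holds_imp fun φ hφ => ?_).symm⟩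
  rw [holds_restrictParams]
  exact hpq () φ hφ

theorem IsReliableCoheir.isReliablyInvariant {A : Set M} {α : Type w} {p : GlobalType L M α}
    (hp : IsReliableCoheir A p) : IsReliablyInvariant A p := by
  obtain ⟨R, hR, hpR⟩ := hp
  exact ⟨R, { hR with subset := fun α p hp => IsCoheir.isInvariantOver (hR.subset α hp) }, hpR⟩

theorem closedUnderSubtuples_of_finset {A : Set M} {I : TypeClass L M}
    (hinv : ∀ (α : Type w), ∀ p ∈ I α, IsInvariantOver A p)
    (hren : ∀ (α β : Type w) (e : α ≃ β), ∀ p ∈ I β, restrictVars e p ∈ I α)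
    (hfin : ∀ (α : Type w) (p : GlobalType L M α), IsInvariantOver A p →
      (p ∈ I α ↔ ∀ s : Finset α, restrictVars (fun z : s => (z : α)) p ∈ I s)) :
    ClosedUnderSubtuples I := by
  intro α β f p hp
  rw [hfin α _ ((hinv β p hp).restrictVars f)]
  intro s
  have hps := hren s (s.map f : Finset β) (s.equivMap f) _
    ((hfin β p (hinv β p hp)).1 hp (s.map f))
  rw [restrictVars_restrictVars] at hps ⊢
  exact hps

end Coheir

end ReliableTypes

theorem mainTheorem4_general {L : FirstOrder.Language.{u, v}} {M : Type w} [L.Structure M]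
    [Nonempty M] {A : Set M} (hs : IsSaturatedOver L A) (hh : IsHomogeneousOver L A) :
    (∀ I : TypeClass L M, ClosedUnderSubtuples I → (∀ α : Type w, IsClosed (I α)) →
      HasExtensions A I → HasExtensions A (Reliably A I)) ∧
    (∀ (α : Type w) (p : GlobalType L M α), IsReliablyInvariant A p → IsKimStrictlyInvariant A p) ∧
    (IsInvarianceBase L A → ∀ (α : Type w) (q : TypeOver L A α), ∃ p : GlobalType L M α,
      restrictParams A p = q ∧ IsReliablyInvariant A p ∧ IsKimStrictlyInvariant A p) ∧
    (∀ N : L.ElementarySubstructure M, (N : Set M) = A →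
      ∀ (α : Type w) (q : TypeOver L A α), ∃ p : GlobalType L M α,
        restrictParams A p = q ∧ IsReliableCoheir A p ∧ IsKimStrictlyInvariant A p) := by
  refine ⟨fun I hsub hcl hex => hex.reliably hs hh hsub hcl,
    fun α p hp => hp.isKimStrictlyInvariant hs hh, fun hbase α q => ?_, ?_⟩
  · have hex : HasExtensions A fun α => {p : GlobalType L M α | IsInvariantOver A p} := hbase
    obtain ⟨p, hp, hpq⟩ := hex.reliably hs hh (closedUnderSubtuples_isInvariantOver A)
      (isClosed_ofPred_isInvariantOver A) α q
    exact ⟨p, hpq, hp, IsReliablyInvariant.isKimStrictlyInvariant hs hh hp⟩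
  · rintro N rfl α q
    have hex : HasExtensions (N : Set M) fun α => {p : GlobalType L M α | IsCoheir (N : Set M) p} :=
      fun α q => exists_isCoheir N q
    obtain ⟨p, hp, hpq⟩ := hex.reliably hs hh (closedUnderSubtuples_isCoheir (N : Set M))
      (isClosed_ofPred_isCoheir (N : Set M)) α q
    have hp' : IsReliableCoheir (N : Set M) p := hp
    exact ⟨p, hpq, hp, hp'.isReliablyInvariant.isKimStrictlyInvariant hs hh⟩

theorem mainTheorem4 {L : FirstOrder.Language.{u, v}} {M : Type w} [L.Structure M] [Nonempty M]
    {κ : Cardinal.{w}} (hM : IsMonster L M κ) (A : Set M) (hA : #A < κ) :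
    -- existence of types that are reliably in `I`
    (∀ I : TypeClass L M,
      (∀ (α : Type w), ∀ p ∈ I α, IsInvariantOver A p) →
      (∀ (α : Type w) (q : TypeOver L A α), ∃ p ∈ I α, restrictParams A p = q) →
      (∀ α : Type w, IsClosed (I α)) →
      (∀ (α β : Type w) (e : α ≃ β), ∀ p ∈ I β, restrictVars e p ∈ I α) →
      (∀ (α : Type w) (p : GlobalType L M α), IsInvariantOver A p →
        (p ∈ I α ↔ ∀ s : Finset α, restrictVars (fun z : s => (z : α)) p ∈ I s)) →
      ∀ (α : Type w) (q : TypeOver L A α), ∃ p : GlobalType L M α,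
        IsInvariantOver A p ∧ restrictParams A p = q ∧ p ∈ Reliably A I α) ∧
    -- reliably invariant types are Kim-strictly invariant
    (∀ (α : Type w) (p : GlobalType L M α), IsReliablyInvariant A p → IsKimStrictlyInvariant A p) ∧
    -- existence of reliably invariant types over invariance bases
    (IsInvarianceBase L A → ∀ (α : Type w) (q : TypeOver L A α), ∃ p : GlobalType L M α,
      restrictParams A p = q ∧ IsReliablyInvariant A p ∧ IsKimStrictlyInvariant A p) ∧
    -- existence of reliable coheirs over models
    (∀ N : L.ElementarySubstructure M, (N : Set M) = A →
      ∀ (α : Type w) (q : TypeOver L A α), ∃ p : GlobalType L M α,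
        restrictParams A p = q ∧ IsReliableCoheir A p ∧ IsKimStrictlyInvariant A p) := by
  obtain ⟨hrel, hrest⟩ := mainTheorem4_general (hM.isSaturatedOver hA) (hM.isHomogeneousOver hA)
  refine ⟨fun I hinv hex hcl hren hfin α q => ?_, hrest⟩
  obtain ⟨p, hp, hpq⟩ := hrel I (closedUnderSubtuples_of_finset hinv hren hfin) hcl hex α q
  exact ⟨p, hinv α p ((isGreatest_reliably A I).1.subset α hp), hpq, hp⟩
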